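/- **Setting.** Fix a finite non-empty alphabet $\Sigma$. Let $X$ be a finite linearly ordered set of string variables, let $\mathcal A_x=(Q_x,\Delta_x,I_x,F_x)$ be an NFA over $\Sigma$ for each $x\in X$ (with pairwise disjoint state sets), let $u=u_1\cdots u_n$ and $v=v_1\cdots v_m$ ($n,m\ge 1$) be concatenations of variables of $X$, and let $\mathcal I$ be a finite conjunction of inequalities $t\le t'$ between linear integer terms over a set of integer variables. Let $\mathcal R$ be the conjunction of the constraints $x\in L(\mathcal A_x)$, $x\in X$, and let $|\mathcal R|=\sum_{x\in X}|Q_x|$. The predicate $\mathrm{contains}(u,v)$ holds under an assignment of words to the variables if the word $w_u$ obtained from $u$ is a factor of the word $w_v$ obtained from $v$. A run of an NFA is a (possibly empty) sequence of consecutive transitions starting in an initial state, and its Parikh image gives the number of occurrences of each transition. An NFA is *flat* if any two of its runs with the same Parikh image are equal. **The tag automaton.** Transitions of a tag automaton are labelled by finite sets of tags. Let $C$ have the states $\bigcup_x Q_x$, a transition $q\xrightarrow{\{S_a,L_x\}}r$ for each $(q,a,r)\in\Delta_x$, $x\in X$, and a transition $q\xrightarrow{\emptyset}r$ for $q\in F_x$,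 $r\in I_y$ whenever $y$ is the immediate successor of $x$ in $X$; its initial (final) states are the initial (final) states of the automaton of the least (greatest) variable. Let $T$ be the tag automaton with the states $(q,i)$, $q$ a state of $C$, $i\in\{1,2,3\}$, the initial states $(q,1)$ with $q$ initial in $C$, the final states $(q,1),(q,3)$ with $q$ final in $C$, the transitions $(q,i)\xrightarrow{\emptyset}(r,i)$, $i=1,2,3$, for each $q\xrightarrow{\emptyset}r$ of $C$, and, for each $q\xrightarrow{\{S_a,L_z\}}r$ of $C$, the transitions $$(q,1)\xrightarrow{\{S_a,P^1_z,L_z\}}(r,1),\quad (q,1)\xrightarrow{\{S_a,M^1_{a,z},P^2_z,L_z\}}(r,2),\quad (q,2)\xrightarrow{\{S_a,P^2_z,L_z\}}(r,2),$$ $$(q,2)\xrightarrow{\{S_a,M^2_{a,z},P^3_z,L_z\}}(r,3),\quad (q,3)\xrightarrow{\{S_a,P^3_z,L_z\}}(r,3).$$ **The formula.** For a set $\#$ of integer variables $\#\delta$ ($\delta$ a transition of $T$), $\#t$ ($t$ a tag) and $\gamma^I_q,\gamma^F_q,\sigma_q$ ($q$ a state of $T$), let $\mathrm{PF}(T,\#)$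 be the conjunction of: $0\le\gamma^I_q\le1$ for $q$ initial, $\gamma^I_q=0$ for other $q$, $\sum_{q\text{ initial}}\gamma^I_q=1$; $0\le\gamma^F_q\le 1$ for $q$ final, $\gamma^F_q=0$ for other $q$; for every state $q$ $$\gamma^I_q+\sum_{\delta\text{ into }q}\#\delta=\gamma^F_q+\sum_{\delta\text{ from }q}\#\delta,\qquad \sigma_q=0\leftrightarrow\gamma^I_q=1,$$ $$\sigma_q\le-1\to\Big(\gamma^I_q=0\wedge\bigwedge_{\delta\text{ into }q}\#\delta=0\Big),\qquad \sigma_q>0\to\bigvee_{\delta\text{ from }q'\text{ into }q}(\#\delta>0\wedge\sigma_{q'}\ge0\wedge\sigma_q=\sigma_{q'}+1);$$ $\#\delta\ge0$ for every $\delta$; and $\#t=\sum\{\#\delta: t \text{ is a tag of }\delta\}$ for every tag $t$. Further let - $\mathrm{Sym}(\#)$ be $\bigwedge_{a\in\Sigma}\sum_{x\in X}(\#M^1_{a,x}+\#M^2_{a,x})<2$; - $\mathrm{Mis}(\kappa,\#)$ be $\bigvee_{i\le n,\,j\le m}\big(\mathrm{Pos}_{i,j}\wedge\sum_a\#M^1_{a,x}>0\wedge\sum_a\#M^2_{a,y}>0\big)$,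 where $x=\min(u_i,v_j)$, $y=\max(u_i,v_j)$ and, with $\ell_u=\sum_{k<i}\#L_{u_k}$ and $\ell_v=\sum_{k<j}\#L_{v_k}$, $\mathrm{Pos}_{i,j}$ is $\kappa+\#P^1_{u_i}+\ell_u=\#P^2_{v_j}+\ell_v$ if $u_i<v_j$; it is $\kappa+\#P^2_{u_i}+\ell_u=\#P^1_{v_j}+\ell_v$ if $u_i>v_j$; and if $u_i=v_j=z$, it is $\kappa+\#P^1_z+\ell_u=\#P^1_z+\#P^2_z+\ell_v\ \vee\ \kappa+\#P^1_z+\#P^2_z+\ell_u=\#P^1_z+\ell_v$; - $\mathrm{Eq}(\#_1,\#_2)$ be the conjunction, over all transitions $q\xrightarrow{\{S_a,L_z\}}r$ of $C$, of $\sum_\delta\#_1\delta=\sum_\delta\#_2\delta$, where $\delta$ ranges over the transitions of $T$ from some $(q,i)$ to some $(r,j)$ whose tags include $S_a$; - $\mathrm{D}(\#)$ be the term $\sum_{j\le m}\#L_{v_j}-\sum_{i\le n}\#L_{u_i}$. Let $$\varphi^{\neg\mathrm{contains}}:\quad \mathrm{PF}(T,\#_1)\wedge\forall\kappa\,\exists\#_2\Big(\big(\mathrm{PF}(T,\#_2)\wedge\mathrm{Eq}(\#_1,\#_2)\wedge\mathrm{Sym}(\#_2)\wedge\mathrm{Mis}(\kappa,\#_2)\big)\vee\kappa<0\vee\kappa>\mathrm{D}(\#_1)\Big),$$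 a formula of linear integer arithmetic with the free variables $\#_1$ (all variables range over $\mathbb Z$). **Theorem.** Suppose that $\mathcal A_x$ is flat for every variable $x$ that occurs in $u$ or $v$. Then $\mathcal R\wedge\mathcal I\wedge\neg\mathrm{contains}(u,v)$ is satisfiable if and only if $\mathcal I\wedge\varphi^{\neg\mathrm{contains}}$ is satisfiable. Moreover, there is a polynomial $p$, depending only on $\Sigma$, such that the size of $\varphi^{\neg\mathrm{contains}}$ is at most $p(nm\cdot|\mathcal R|)$ whenever every $\mathcal A_x$ has at least one state. -/

import Mathlib

/-! ### Linear integer arithmetic (LIA): syntax, semantics, size -/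

/-- Linear integer terms over variables from `V`. -/
inductive LIATerm (V : Type*) where
  | var (x : V) : LIATerm V
  | const (k : ℤ) : LIATerm V
  | add (s t : LIATerm V) : LIATerm V
  | sub (s t : LIATerm V) : LIATerm V

namespace LIATerm

variable {V W : Type*}

def eval (α : V → ℤ) : LIATerm V → ℤ
  | var x => α x
  | const k => k
  | add s t => s.eval α + t.eval α
  | sub s t => s.eval α - t.eval α

/-- Number of symbols; an integer constant is counted with its binary length. -/
def size : LIATerm V → ℕ
  | var _ => 1
  | const k => 1 + Nat.size k.natAbs
  | add s t => s.size + t.size + 1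
  | sub s t => s.size + t.size + 1

def rename (f : V → W) : LIATerm V → LIATerm W
  | var x => var (f x)
  | const k => const k
  | add s t => add (s.rename f) (t.rename f)
  | sub s t => sub (s.rename f) (t.rename f)

def sum (l : List (LIATerm V)) : LIATerm V :=
  l.foldr add (const 0)

end LIATerm

/-- LIA formulae over variables from `V`; `all S φ` and `ex S φ` quantify over all the (finitely
many) variables in the block `S`. -/
inductive LIAFormula (V : Type*) where
  | le (s t : LIATerm V) : LIAFormula V
  | eq (s t : LIATerm V) : LIAFormula V
  | not (φ : LIAFormula V) : LIAFormula V
  | and (φ ψ : LIAFormula V) : LIAFormula V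
  | or (φ ψ : LIAFormula V) : LIAFormula V
  | all (S : Finset V) (φ : LIAFormula V) : LIAFormula V
  | ex (S : Finset V) (φ : LIAFormula V) : LIAFormula V

namespace LIAFormula

variable {V : Type*}

/-- `φ.holds α`: the integer assignment `α` is a model of `φ`. -/
def holds : LIAFormula V → (V → ℤ) → Prop
  | le s t, α => s.eval α ≤ t.eval α
  | eq s t, α => s.eval α = t.eval α
  | not φ, α => ¬ φ.holds α
  | and φ ψ, α => φ.holds α ∧ ψ.holds α
  | or φ ψ, α => φ.holds α ∨ ψ.holds α
  | all S φ, α => ∀ β : V → ℤ, (∀ x, x ∉ S → β x = α x) → φ.holds β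
  | ex S φ, α => ∃ β : V → ℤ, (∀ x, x ∉ S → β x = α x) ∧ φ.holds β

/-- Number of symbols, where a quantifier block counts all the variables it binds. -/
def size : LIAFormula V → ℕ
  | le s t => s.size + t.size + 1
  | eq s t => s.size + t.size + 1
  | not φ => φ.size + 1
  | and φ ψ => φ.size + ψ.size + 1
  | or φ ψ => φ.size + ψ.size + 1
  | all S φ => S.card + φ.size + 1
  | ex S φ => S.card + φ.size + 1

def Satisfiable (φ : LIAFormula V) : Prop :=
  ∃ α : V → ℤ, φ.holds α

def lt (s t : LIATerm V) : LIAFormula V :=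
  le (s.add (.const 1)) t

def imp (φ ψ : LIAFormula V) : LIAFormula V :=
  or (not φ) ψ

def iff (φ ψ : LIAFormula V) : LIAFormula V :=
  and (imp φ ψ) (imp ψ φ)

def conj (l : List (LIAFormula V)) : LIAFormula V :=
  l.foldr and (le (.const 0) (.const 0))

def disj (l : List (LIAFormula V)) : LIAFormula V :=
  l.foldr or (le (.const 1) (.const 0))

end LIAFormula

/-! ### Flat automata -/

namespace NFA

variable {A Q : Type*}

/-- `ρ` is a run of `M`: a sequence of consecutive transitions of `M`, the first of which leaves
an initial state. A transition from `q` to `r` reading `a` is the triple `(q, a, r)`. -/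
def IsRun (M : NFA A Q) (ρ : List (Q × A × Q)) : Prop :=
  (∀ t ∈ ρ, t.2.2 ∈ M.step t.1 t.2.1) ∧
  (∀ t ∈ ρ.head?, t.1 ∈ M.start) ∧
  ρ.IsChain (fun s t => s.2.2 = t.1)

open scoped Classical in
/-- Parikh image of a run: the number of occurrences of each transition. -/
noncomputable def parikh (ρ : List (Q × A × Q)) : Q × A × Q → ℕ :=
  fun t => ρ.countP fun s => s = t

/-- `M` is flat: every run is determined by its Parikh image. -/
def IsFlat (M : NFA A Q) : Prop :=
  ∀ ρ₁ ρ₂ : List (Q × A × Q), M.IsRun ρ₁ → M.IsRun ρ₂ → parikh ρ₁ = parikh ρ₂ → ρ₁ = ρ₂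

end NFA

/-! ### Tag automata and their Parikh formulae -/

/-- A tag automaton with set of states `S` and (finite) set of tags `tags`. -/
structure TagAutomaton (T S : Type*) where
  tags : Finset T
  trans : Finset (S × Finset T × S)
  init : Finset S
  final : Finset S

/-- The variables of the Parikh tag formula: the numbers of occurrences of transitions and of tags,
and for every state the indicators of being the first and the last state of the run, and the
distance from the first state in a spanning tree of the run (negative for unvisited states). -/
inductive ParikhVar (T S : Type*) where
  | trans (δ : S × Finset T × S) : ParikhVar T S
  | tag (t : T) : ParikhVar T S
  | init (q : S) : ParikhVar T S
  | final (q : S) : ParikhVar T S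
  | span (q : S) : ParikhVar T S

namespace TagAutomaton

open LIATerm LIAFormula

variable {T S V : Type*} [Fintype S] (B : TagAutomaton T S) (ν : ParikhVar T S → V)

open scoped Classical in
/-- All the variables that occur in the Parikh tag formula of `B`. -/
noncomputable def parikhVars : Finset (ParikhVar T S) :=
  B.trans.image .trans ∪ B.tags.image .tag ∪ Finset.univ.image .init ∪
    Finset.univ.image .final ∪ Finset.univ.image .span

/-! In the following formulae, `ν` is the naming of the Parikh variables. -/

open scoped Classical in
/-- The sum of the counts of all transitions of `B` that satisfy `P`. -/
noncomputable def transSum (P : S × Finset T × S → Prop) : LIATerm V :=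
  LIATerm.sum ((B.trans.filter P).toList.map fun δ => var (ν (.trans δ)))

open scoped Classical in
noncomputable def initFormula : LIAFormula V :=
  and (conj (B.init.toList.map fun q =>
        and (le (const 0) (var (ν (.init q)))) (le (var (ν (.init q))) (const 1))))
    (and (conj ((Finset.univ \ B.init).toList.map fun q => eq (var (ν (.init q))) (const 0)))
      (eq (LIATerm.sum (B.init.toList.map fun q => var (ν (.init q)))) (const 1)))

open scoped Classical in
noncomputable def finalFormula : LIAFormula V :=
  and (conj (B.final.toList.map fun q =>
        and (le (const 0) (var (ν (.final q)))) (le (var (ν (.final q))) (const 1))))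
    (conj ((Finset.univ \ B.final).toList.map fun q => eq (var (ν (.final q))) (const 0)))

/-- Kirchhoff's law for the state `q`. -/
noncomputable def kirchhoffFormula (q : S) : LIAFormula V :=
  eq (add (var (ν (.init q))) (B.transSum ν fun δ => δ.2.2 = q))
    (add (var (ν (.final q))) (B.transSum ν fun δ => δ.1 = q))

open scoped Classical in
/-- Consistency of the spanning tree at the state `q`. -/
noncomputable def spanFormula (q : S) : LIAFormula V :=
  and (iff (eq (var (ν (.span q))) (const 0)) (eq (var (ν (.init q))) (const 1)))
    (and
      (imp (le (var (ν (.span q))) (const (-1)))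
        (and (eq (var (ν (.init q))) (const 0))
          (conj ((B.trans.filter fun δ => δ.2.2 = q).toList.map fun δ =>
            eq (var (ν (.trans δ))) (const 0)))))
      (imp (lt (const 0) (var (ν (.span q))))
        (disj ((B.trans.filter fun δ => δ.2.2 = q).toList.map fun δ =>
          and (lt (const 0) (var (ν (.trans δ))))
            (and (le (const 0) (var (ν (.span δ.1))))
              (eq (var (ν (.span q))) (add (var (ν (.span δ.1))) (const 1))))))))

/-- The Parikh formula of `B`. The last conjunct says that the counts are natural numbers. -/
noncomputable def parikhFormula : LIAFormula V :=
  and (B.initFormula ν)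
    (and (B.finalFormula ν)
      (and (conj ((Finset.univ : Finset S).toList.map fun q =>
          and (B.kirchhoffFormula ν q) (B.spanFormula ν q)))
        (conj (B.trans.toList.map fun δ => le (const 0) (var (ν (.trans δ)))))))

/-- The Parikh tag formula of `B`. -/
noncomputable def parikhTagFormula : LIAFormula V :=
  and (B.parikhFormula ν)
    (conj (B.tags.toList.map fun t =>
      eq (var (ν (.tag t))) (B.transSum ν fun δ => t ∈ δ.2.1)))

end TagAutomaton

/-! ### The tag automaton of a single constraint with two mismatching positions -/

/-- Tags: read symbol, length, first and second mismatch, and positions. -/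
inductive Tag (A X : Type*) where
  | sym (a : A) : Tag A X
  | len (x : X) : Tag A X
  | mis₁ (a : A) (x : X) : Tag A X
  | mis₂ (a : A) (x : X) : Tag A X
  | pos₁ (x : X) : Tag A X
  | pos₂ (x : X) : Tag A X
  | pos₃ (x : X) : Tag A X

namespace NotContains

open LIATerm LIAFormula

variable {A X : Type*} [Fintype A] [Fintype X]

open scoped Classical in
/-- The tag automaton of an NFA `M` for the variable `x`, where every transition reading `a` is
tagged by the symbol `a` and the length tag of `x`. -/
noncomputable def lenTag {Q : Type*} [Fintype Q] (x : X) (M : NFA A Q) :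
    TagAutomaton (Tag A X) Q where
  tags := Finset.univ.image .sym ∪ {.len x}
  trans := ((Finset.univ : Finset (Q × A × Q)).filter fun t => t.2.2 ∈ M.step t.1 t.2.1).image
    fun t => (t.1, {.sym t.2.1, .len x}, t.2.2)
  init := Finset.univ.filter fun q => q ∈ M.start
  final := Finset.univ.filter fun q => q ∈ M.accept

variable [LinearOrder X]

open scoped Classical in
/-- The `ε`-concatenation of the tag automata `B x`, `x : X`, in the order of `X`: untagged
transitions lead from the final states of `B x` to the initial states of `B y` whenever `y` is the
immediate successor of `x`. -/
noncomputable def epsConcat {Q : X → Type*} [∀ x, Fintype (Q x)]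
    (B : ∀ x, TagAutomaton (Tag A X) (Q x)) : TagAutomaton (Tag A X) (Σ x, Q x) where
  tags := Finset.univ.biUnion fun x => (B x).tags
  trans :=
    (Finset.univ.biUnion fun x => (B x).trans.image fun t => (⟨x, t.1⟩, t.2.1, ⟨x, t.2.2⟩)) ∪
    ((Finset.univ : Finset ((Σ x, Q x) × (Σ x, Q x))).filter fun p =>
        p.1.1 ⋖ p.2.1 ∧ p.1.2 ∈ (B p.1.1).final ∧ p.2.2 ∈ (B p.2.1).init).image
      fun p => (p.1, ∅, p.2)
  init := Finset.univ.filter fun q => IsBot q.1 ∧ q.2 ∈ (B q.1).init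
  final := Finset.univ.filter fun q => IsTop q.1 ∧ q.2 ∈ (B q.1).final

open scoped Classical in
/-- The transitions of `C` that read the symbol `a` in the variable `z`. -/
noncomputable def letterTrans {S : Type*} (C : TagAutomaton (Tag A X) S) (a : A) (z : X) :
    Finset (S × Finset (Tag A X) × S) :=
  C.trans.filter fun t => t.2.1 = {.sym a, .len z}

open scoped Classical in
/-- Three copies of `C`, numbered `0, 1, 2` by the number of mismatches seen so far. -/
noncomputable def threeCopies {S : Type*} (C : TagAutomaton (Tag A X) S) :
    TagAutomaton (Tag A X) (S × Fin 3) where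
  tags := C.tags ∪
    (Finset.univ : Finset (A × X)).image (fun p => .mis₁ p.1 p.2) ∪
    (Finset.univ : Finset (A × X)).image (fun p => .mis₂ p.1 p.2) ∪
    Finset.univ.image .pos₁ ∪ Finset.univ.image .pos₂ ∪ Finset.univ.image .pos₃
  trans :=
    ((Finset.univ : Finset (A × X)).biUnion fun p => (letterTrans C p.1 p.2).biUnion fun t =>
      { ((t.1, 0), {.sym p.1, .pos₁ p.2, .len p.2}, (t.2.2, 0)),
        ((t.1, 0), {.sym p.1, .mis₁ p.1 p.2, .pos₂ p.2, .len p.2}, (t.2.2, 1)),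
        ((t.1, 1), {.sym p.1, .pos₂ p.2, .len p.2}, (t.2.2, 1)),
        ((t.1, 1), {.sym p.1, .mis₂ p.1 p.2, .pos₃ p.2, .len p.2}, (t.2.2, 2)),
        ((t.1, 2), {.sym p.1, .pos₃ p.2, .len p.2}, (t.2.2, 2)) }) ∪
    ((C.trans.filter fun t => t.2.1 = ∅).biUnion fun t =>
      Finset.univ.image fun i : Fin 3 => ((t.1, i), ∅, (t.2.2, i)))
  init := C.init ×ˢ {0}
  final := C.final ×ˢ {0, 2}

section Formula

variable {S V : Type*} [Fintype S]

/-- The count of the tag `t`, where `ν` is the naming of the Parikh variables. -/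
def tagCount {S' : Type*} (ν : ParikhVar (Tag A X) S' → V) (t : Tag A X) : LIATerm V :=
  var (ν (.tag t))

/-- The length of a concatenation of variables. -/
def lenSum {S' : Type*} (ν : ParikhVar (Tag A X) S' → V) (w : List X) : LIATerm V :=
  LIATerm.sum (w.map fun x => tagCount ν (.len x))

/-- The two mismatching symbols are different. -/
noncomputable def symFormula {S' : Type*} (ν : ParikhVar (Tag A X) S' → V) : LIAFormula V :=
  conj ((Finset.univ : Finset A).toList.map fun a =>
    lt (LIATerm.sum ((Finset.univ : Finset X).toList.map fun x =>
      add (tagCount ν (.mis₁ a x)) (tagCount ν (.mis₂ a x)))) (const 2))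

/-- The mismatch position in the occurrence `u[i]`, shifted by the offset `κ`, is the mismatch
position in the occurrence `v[j]`. -/
noncomputable def posFormula {S' : Type*} (κ : V) (ν : ParikhVar (Tag A X) S' → V)
    (u v : List X) (i : Fin u.length) (j : Fin v.length) : LIAFormula V :=
  let x := u.get i
  let y := v.get j
  let preU := lenSum ν (u.take i)
  let preV := lenSum ν (v.take j)
  if x = y then
    or
      (eq (add (var κ) (add (tagCount ν (.pos₁ x)) preU))
        (add (add (tagCount ν (.pos₁ x)) (tagCount ν (.pos₂ x))) preV))
      (eq (add (var κ) (add (add (tagCount ν (.pos₁ x)) (tagCount ν (.pos₂ x))) preU))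
        (add (tagCount ν (.pos₁ x)) preV))
  else if x < y then
    eq (add (var κ) (add (tagCount ν (.pos₁ x)) preU)) (add (tagCount ν (.pos₂ y)) preV)
  else
    eq (add (var κ) (add (tagCount ν (.pos₂ x)) preU)) (add (tagCount ν (.pos₁ y)) preV)

/-- There is a first mismatch in the variable `x` and a second mismatch in the variable `y`. -/
noncomputable def sampledFormula {S' : Type*} (ν : ParikhVar (Tag A X) S' → V) (x y : X) :
    LIAFormula V :=
  and
    (lt (const 0) (LIATerm.sum ((Finset.univ : Finset A).toList.map fun a =>
      tagCount ν (.mis₁ a x))))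
    (lt (const 0) (LIATerm.sum ((Finset.univ : Finset A).toList.map fun a =>
      tagCount ν (.mis₂ a y))))

/-- There are mismatch positions, one in an occurrence of a variable in `u` and one in an
occurrence of a variable in `v`, that are aligned when `u` is shifted by `κ`. -/
noncomputable def misFormula {S' : Type*} (κ : V) (ν : ParikhVar (Tag A X) S' → V)
    (u v : List X) : LIAFormula V :=
  disj ((List.finRange u.length).flatMap fun i => (List.finRange v.length).map fun j =>
    and (posFormula κ ν u v i j)
      (if u.get i ≤ v.get j then sampledFormula ν (u.get i) (v.get j)
        else sampledFormula ν (v.get j) (u.get i)))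

/-- The copies in `threeCopies C` of a transition `t` of `C` that reads `a` are taken equally often
in the two runs with Parikh variables `ν₁` and `ν₂`, for all `t` and `a`. -/
noncomputable def equalWordFormula (C : TagAutomaton (Tag A X) S)
    (ν₁ ν₂ : ParikhVar (Tag A X) (S × Fin 3) → V) : LIAFormula V :=
  conj ((Finset.univ : Finset (A × X)).toList.flatMap fun p =>
    (letterTrans C p.1 p.2).toList.map fun t =>
      let copies := fun r : (S × Fin 3) × Finset (Tag A X) × (S × Fin 3) =>
        r.1.1 = t.1 ∧ r.2.2.1 = t.2.2 ∧ .sym p.1 ∈ r.2.1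
      eq ((threeCopies C).transSum ν₁ copies) ((threeCopies C).transSum ν₂ copies))

/-- The length of `v` minus the length of `u`. -/
def lenDiff {S' : Type*} (ν : ParikhVar (Tag A X) S' → V) (u v : List X) : LIATerm V :=
  sub (lenSum ν v) (lenSum ν u)

end Formula

/-- Variables of the resulting formula: the integer variables `I` of the input, two disjoint sets
of Parikh variables, and the offset. -/
inductive Var (I T S : Type*) where
  | int (i : I) : Var I T S
  | fst (p : ParikhVar T S) : Var I T S
  | snd (p : ParikhVar T S) : Var I T S
  | offset : Var I T S

variable (I : Type*) {Q : X → Type*} [∀ x, Fintype (Q x)]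

open scoped Classical in
/-- The LIA formula for the constraint that the value of `v` does not contain the value of `u`,
where the values of each variable `x` are restricted to the language of `aut x`. -/
noncomputable def formula (aut : ∀ x, NFA A (Q x)) (u v : List X) :
    LIAFormula (Var I (Tag A X) ((Σ x, Q x) × Fin 3)) :=
  let C := epsConcat fun x => lenTag x (aut x)
  let B := threeCopies C
  and (B.parikhTagFormula .fst)
    (all {.offset} (ex (B.parikhVars.image .snd)
      (or
        (and (B.parikhTagFormula .snd)
          (and (equalWordFormula C .fst .snd)
            (and (symFormula .snd) (misFormula .offset .snd u v))))
        (or (lt (var .offset) (const 0))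
          (lt (lenDiff .fst u v) (var .offset))))))

variable {I}

/-- The conjunction of the integer constraints `c.1 ≤ c.2`, for `c` in `ints`. -/
def intFormula {T S : Type*} (ints : List (LIATerm I × LIATerm I)) : LIAFormula (Var I T S) :=
  conj (ints.map fun c => le (c.1.rename .int) (c.2.rename .int))

end NotContains

/-! ### The string constraint -/

/-- The value of a string term, i.e. of a concatenation of variables. -/
def termValue {A X : Type*} (σ : X → List A) (w : List X) : List A :=
  (w.map σ).flatten

/-- Satisfiability of the conjunction of the regular constraints `x ∈ L(aut x)` for all `x`, of the
integer constraints `c.1 ≤ c.2` for `c` in `ints`, and of `¬contains(u, v)`, where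
`contains(u, v)` says that the value of `u` is a factor of the value of `v`. -/
def NotContainsSatisfiable {A X I : Type*} {Q : X → Type*} (aut : ∀ x, NFA A (Q x))
    (ints : List (LIATerm I × LIATerm I)) (u v : List X) : Prop :=
  ∃ (σ : X → List A) (η : I → ℤ),
    (∀ x, σ x ∈ (aut x).accepts) ∧
    (∀ c ∈ ints, c.1.eval η ≤ c.2.eval η) ∧
    ¬ termValue σ u <:+: termValue σ v

/-! An accepting run of the tag automaton amounts to one accepting path in the automaton of every
variable, traversed in the order of the variables. Since the middle copy has no final state, the run
samples either no letter or exactly two (`exists_describes`).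

The Parikh tag formula captures exactly these runs up to the order of transitions. Kirchhoff's law
makes the transition counts a balanced multigraph, and the `span` values show that every used
transition is reachable from the initial state, so an Eulerian path exists (`exists_run_of_holds`).
Conversely, a run supplies the values, its `span` values being depths in a spanning tree
(`IsAcceptingRun.exists_values`).

The value of `u` is not a factor of that of `v` iff every offset κ that leaves room for it gives a
mismatch (`not_isInfix_iff`). A mismatch is a pair of different letters, one in an occurrence in `u`
and one in an occurrence in `v`. Position tags count the letters before each sampled letter within
its own word, and length tags measure the preceding words, so the mismatch formula expresses
alignment at offset κ (`holds_misFormula_iff`).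

The second run may depend on κ but has to read the same words as the first, whereas the formula only
equates transition counts. For the variables of `u` and `v`, flatness upgrades equal counts to equal
paths (`exists_mismatch_of_holds`). This is the only use of flatness. In the other direction the
paths of the first run are kept and two of their letters are marked (`exists_values_of_mismatch`).

For the size, one number `M` bounds all index sets, the formula is cubic in `M`, and `M` can be
chosen of degree 4 in nm|R|, which gives degree 12. -/

/-! ### Paths and Eulerian paths in multigraphs -/

section Paths

variable {S E : Type*} (src tgt : E → S)

/-- `IsPath src tgt p l r`: the edges of `l` form a path from `p` to `r`. -/
def IsPath : S → List E → S → Prop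
  | p, [], r => p = r
  | p, e :: l, r => src e = p ∧ IsPath (tgt e) l r

/-- The in- and outdegrees in `M` agree, except for what a path from `a` to `b` allows. -/
def IsBalanced (M : Multiset E) (a b : S) : Prop :=
  ∀ P : S → Prop, ∀ [DecidablePred P],
    M.countP (fun e => P (tgt e)) + (if P a then 1 else 0) =
      M.countP (fun e => P (src e)) + (if P b then 1 else 0)

variable {src tgt}

@[simp] theorem isPath_nil {p r : S} : IsPath src tgt p [] r ↔ p = r := Iff.rfl

@[simp] theorem isPath_cons {p r : S} {e : E} {l : List E} :
    IsPath src tgt p (e :: l) r ↔ src e = p ∧ IsPath src tgt (tgt e) l r := Iff.rfl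

theorem isPath_append {p r : S} {l₁ l₂ : List E} :
    IsPath src tgt p (l₁ ++ l₂) r ↔ ∃ q, IsPath src tgt p l₁ q ∧ IsPath src tgt q l₂ r := by
  induction l₁ generalizing p with
  | nil => simp
  | cons e l₁ ih => simp [ih, and_assoc]

theorem isPath_map {E' S' : Type*} {src' tgt' : E' → S'} (f : E → E') (g : S → S')
    (hs : ∀ e, src' (f e) = g (src e)) (ht : ∀ e, tgt' (f e) = g (tgt e))
    {p r : S} {l : List E} (h : IsPath src tgt p l r) :
    IsPath src' tgt' (g p) (l.map f) (g r) := by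
  induction l generalizing p with
  | nil => simpa using congrArg g h
  | cons e l ih => exact ⟨by rw [hs, h.1], by rw [ht]; exact ih h.2⟩

theorem IsPath.balanced {p r : S} {l : List E} (h : IsPath src tgt p l r) :
    IsBalanced src tgt (l : Multiset E) p r := by
  intro P _
  induction l generalizing p with
  | nil => obtain rfl : p = r := h; simp
  | cons e l ih =>
    obtain ⟨rfl, h⟩ := h
    have := ih h
    simp only [Multiset.coe_countP, List.countP_cons, decide_eq_true_eq] at this ⊢
    omega

/-- The balance equations subtract. Removing a path from `a` to `c` moves the start to `c`; in
particular, removing a complete path from `a` to `b` leaves a remainder balanced from `b` to `b`. -/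
theorem IsBalanced.sub [DecidableEq E] {M N : Multiset E} {a b c : S}
    (hM : IsBalanced src tgt M a b) (hN : IsBalanced src tgt N a c) (hle : N ≤ M) :
    IsBalanced src tgt (M - N) c b := by
  intro P _
  have h₁ := hM P
  have h₂ := hN P
  rw [← Multiset.sub_add_cancel hle] at h₁
  simp only [Multiset.countP_add] at h₁
  omega

/-- In a balanced multigraph, a path can be extended until it ends in the right vertex. -/
theorem IsBalanced.exists_path {M : Multiset E} {a b : S} (h : IsBalanced src tgt M a b) :
    ∃ l : List E, (l : Multiset E) ≤ M ∧ IsPath src tgt a l b := by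
  classical
  induction hn : M.card generalizing M a with
  | zero =>
    obtain rfl := Multiset.card_eq_zero.1 hn
    refine ⟨[], le_rfl, ?_⟩
    have := h (· = b)
    simpa using this
  | succ n ih =>
    by_cases hab : a = b
    · exact ⟨[], by simp, hab⟩
    -- For `a ≠ b`, balance at the single vertex `a` gives one more outgoing than incoming edge, so
    -- some edge leaves `a`.
    have h₁ := h (· = a)
    simp only [if_true, Ne.symm hab, if_false] at h₁
    obtain ⟨e, he, rfl⟩ := Multiset.countP_pos.1 (show 0 < M.countP (fun e => src e = a) by omega)
    have hb : IsBalanced src tgt (M - {e}) (tgt e) b := by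
      refine h.sub ?_ (Multiset.singleton_le.2 he)
      exact IsPath.balanced (l := [e]) ⟨rfl, rfl⟩
    obtain ⟨l, hl, hp⟩ := ih hb (by
      rw [Multiset.card_sub (Multiset.singleton_le.2 he), hn]; simp)
    refine ⟨e :: l, ?_, rfl, hp⟩
    rw [← Multiset.cons_coe, ← Multiset.singleton_add, add_comm]
    exact (Multiset.add_le_add_iff_right.2 hl).trans
      (Multiset.sub_add_cancel (Multiset.singleton_le.2 he)).le

/-- A path within a connected balanced multigraph extends to an Eulerian path. -/
theorem IsBalanced.exists_eulerian_of_path {M : Multiset E} {a b : S}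
    (h : IsBalanced src tgt M a b)
    (hconn : ∀ V : Set S, a ∈ V → (∀ e ∈ M, src e ∈ V → tgt e ∈ V) → ∀ e ∈ M, src e ∈ V)
    (l : List E) (hl : (l : Multiset E) ≤ M) (hp : IsPath src tgt a l b) :
    ∃ l' : List E, (l' : Multiset E) = M ∧ IsPath src tgt a l' b := by
  classical
  induction hn : M.card - l.length using Nat.strong_induction_on generalizing l with
  | _ n ih =>
  by_cases hlM : (l : Multiset E) = M
  · exact ⟨l, hlM, hp⟩
  set N := M - (l : Multiset E) with hN
  have hMN : N + l = M := Multiset.sub_add_cancel hl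
  have hbal : IsBalanced src tgt N b b := h.sub hp.balanced hl
  have hN0 : N ≠ 0 := by
    intro h0
    rw [h0, zero_add] at hMN
    exact hlM hMN
  -- Some unused edge leaves a vertex on the path. Otherwise the visited vertices would be closed
  -- under all edges of `M`, and by `hconn` even the unused edges would start there.
  obtain ⟨e, he, l₁, l₂, rfl, hp₁, hp₂⟩ : ∃ e ∈ N, ∃ l₁ l₂, l = l₁ ++ l₂ ∧
      IsPath src tgt a l₁ (src e) ∧ IsPath src tgt (src e) l₂ b := by
    by_contra! hcon
    have key := hconn {q | ∃ l₁ l₂, l = l₁ ++ l₂ ∧ IsPath src tgt a l₁ q ∧ IsPath src tgt q l₂ b}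
      ⟨[], l, rfl, rfl, hp⟩ (by
        intro e he ⟨l₁, l₂, h₁, h₂, h₃⟩
        rw [← hMN, Multiset.mem_add] at he
        rcases he with he | he
        · exact (hcon e he l₁ l₂ h₁ h₂ h₃).elim
        · obtain ⟨k₁, k₂, rfl⟩ := List.append_of_mem (Multiset.mem_coe.1 he)
          obtain ⟨q, hq₁, hq₂, hq₃⟩ := isPath_append.1 hp
          exact ⟨k₁ ++ [e], k₂, by simp, isPath_append.2 ⟨q, hq₁, hq₂, rfl⟩, hq₃⟩)
    obtain ⟨e, he⟩ := Multiset.exists_mem_of_ne_zero hN0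
    obtain ⟨l₁, l₂, h₁, h₂, h₃⟩ := key e (by rw [← hMN]; exact Multiset.mem_add.2 (.inl he))
    exact hcon e he l₁ l₂ h₁ h₂ h₃
  -- A multigraph balanced from `b` to `b` is balanced from any vertex to itself. Hence `e` closes
  -- up to a cycle of unused edges, which is spliced into the path at `src e`.
  have hbal' : IsBalanced src tgt (N - {e}) (tgt e) (src e) := by
    refine IsBalanced.sub (a := src e) ?_ (IsPath.balanced (l := [e]) ⟨rfl, rfl⟩)
      (Multiset.singleton_le.2 he)
    intro P _
    have := hbal P
    omega
  obtain ⟨k, hk, hkp⟩ := hbal'.exists_path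
  have hle : (((l₁ ++ (e :: k ++ l₂) : List E)) : Multiset E) ≤ M := by
    have h₁ : ((e :: k : List E) : Multiset E) ≤ N := by
      rw [← Multiset.cons_coe, ← Multiset.singleton_add, add_comm]
      exact (Multiset.add_le_add_iff_right.2 hk).trans
        (Multiset.sub_add_cancel (Multiset.singleton_le.2 he)).le
    rw [← hMN]
    simp only [← Multiset.coe_add] at h₁ ⊢
    rw [add_left_comm]
    exact Multiset.add_le_add_iff_right.2 h₁
  refine ih _ ?_ _ hle (isPath_append.2 ⟨_, hp₁, isPath_append.2 ⟨src e, ⟨rfl, hkp⟩, hp₂⟩⟩) rfl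
  have := Multiset.card_le_card hle
  simp only [Multiset.coe_card, List.length_append, List.length_cons] at this hn ⊢
  omega

/-- A connected balanced multigraph has an Eulerian path. -/
theorem IsBalanced.exists_eulerian {M : Multiset E} {a b : S} (h : IsBalanced src tgt M a b)
    (hconn : ∀ V : Set S, a ∈ V → (∀ e ∈ M, src e ∈ V → tgt e ∈ V) → ∀ e ∈ M, src e ∈ V) :
    ∃ l : List E, (l : Multiset E) = M ∧ IsPath src tgt a l b := by
  obtain ⟨l, hl, hp⟩ := h.exists_path
  exact h.exists_eulerian_of_path hconn l hl hp

end Paths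

/-! ### Semantics of the Parikh tag formula -/

namespace LIATerm

variable {V W : Type*}

theorem eval_sum (α : V → ℤ) (l : List (LIATerm V)) :
    (LIATerm.sum l).eval α = (l.map (eval α)).sum := by
  induction l with
  | nil => rfl
  | cons t l ih => rw [List.map_cons, List.sum_cons, ← ih]; rfl

theorem eval_rename (f : V → W) (α : W → ℤ) (t : LIATerm V) :
    (t.rename f).eval α = t.eval (α ∘ f) := by
  induction t with
  | var x => rfl
  | const k => rfl
  | add s t hs ht => simp [rename, eval, hs, ht]
  | sub s t hs ht => simp [rename, eval, hs, ht]

end LIATerm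

namespace LIAFormula

variable {V : Type*}

theorem holds_conj {α : V → ℤ} {l : List (LIAFormula V)} :
    (conj l).holds α ↔ ∀ φ ∈ l, φ.holds α := by
  induction l with
  | nil => simp [conj, holds]
  | cons φ l ih => rw [List.forall_mem_cons, ← ih]; rfl

theorem holds_disj {α : V → ℤ} {l : List (LIAFormula V)} :
    (disj l).holds α ↔ ∃ φ ∈ l, φ.holds α := by
  induction l with
  | nil => simp [disj, holds, LIATerm.eval]
  | cons φ l ih => rw [List.exists_mem_cons_iff, ← ih]; rfl

theorem holds_lt {α : V → ℤ} {s t : LIATerm V} : (lt s t).holds α ↔ s.eval α < t.eval α :=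
  Iff.rfl

theorem holds_imp {α : V → ℤ} {φ ψ : LIAFormula V} :
    (imp φ ψ).holds α ↔ (φ.holds α → ψ.holds α) := by
  simp only [imp, holds]
  tauto

theorem holds_iff {α : V → ℤ} {φ ψ : LIAFormula V} :
    (iff φ ψ).holds α ↔ (φ.holds α ↔ ψ.holds α) := by
  simp only [iff, holds, holds_imp]
  tauto

end LIAFormula

open scoped Classical in
/-- The number of elements of `l` that satisfy `P`. -/
noncomputable def occ {E : Type*} (P : E → Prop) (l : List E) : ℕ :=
  l.countP fun e => P e

section Occ

variable {E F : Type*} (P : E → Prop)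

theorem occ_eq_countP [DecidablePred P] (l : List E) : occ P l = l.countP fun e => P e := by
  exact List.countP_congr (by simp)

@[simp] theorem occ_nil : occ P [] = 0 := rfl

theorem occ_cons [DecidablePred P] (e : E) (l : List E) :
    occ P (e :: l) = (if P e then 1 else 0) + occ P l := by
  simp [occ_eq_countP, List.countP_cons, add_comm]

theorem occ_append (l₁ l₂ : List E) : occ P (l₁ ++ l₂) = occ P l₁ + occ P l₂ :=
  List.countP_append

theorem occ_map (f : F → E) (l : List F) : occ P (l.map f) = occ (fun e => P (f e)) l := by
  simp [occ, List.countP_map, Function.comp_def]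

theorem occ_pos {l : List E} : 0 < occ P l ↔ ∃ e ∈ l, P e := by
  simp [occ, List.countP_pos_iff]

theorem occ_eq_zero {l : List E} : occ P l = 0 ↔ ∀ e ∈ l, ¬ P e := by
  simp [occ, List.countP_eq_zero]

/-- Turns sums of transition counts, which is what the formulae contain, into counts along a run. -/
theorem sum_occ_eq [DecidablePred P] (s : Finset E) (l : List E) (hl : ∀ e ∈ l, e ∈ s) :
    ∑ e ∈ s with P e, (occ (fun d => d = e) l : ℤ) = occ P l := by
  classical
  induction l with
  | nil => simp
  | cons d l ih =>
    simp only [List.forall_mem_cons] at hl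
    simp only [occ_cons, Nat.cast_add, Finset.sum_add_distrib, ih hl.2,
      Nat.cast_ite, Nat.cast_one, Nat.cast_zero, Finset.sum_ite_eq, Finset.mem_filter, hl.1,
      true_and]

end Occ

-- Summing the equations of the single vertices over `P` gives the equation for `P`. This is how
-- Kirchhoff's law for each state enters.
open scoped Classical in
theorem isBalanced_of_forall_eq {S E : Type*} [Finite S] {src tgt : E → S} {M : Multiset E}
    {a b : S} (h : ∀ q, M.countP (fun e => tgt e = q) + (if q = a then 1 else 0) =
      M.countP (fun e => src e = q) + if q = b then 1 else 0) :
    IsBalanced src tgt M a b := by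
  have := Fintype.ofFinite S
  intro P _
  have key (f : E → S) (N : Multiset E) :
      N.countP (fun e => P (f e)) = ∑ q with P q, N.countP (fun e => f e = q) := by
    induction N using Multiset.induction with
    | empty => simp
    | cons e N ih => simp [Multiset.countP_cons, Finset.sum_add_distrib, ih]
  have := Finset.sum_congr rfl (s₁ := Finset.univ.filter P) fun q _ => h q
  simpa [Finset.sum_add_distrib, ← key] using this

/-- Depths of the vertices in a spanning tree of a path, negative for unvisited vertices. -/
theorem IsPath.exists_depth {S E : Type*} {src tgt : E → S} {p r : S} {l : List E}
    (h : IsPath src tgt p l r) :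
    ∃ d : S → ℤ, (∀ q, d q = 0 ↔ q = p) ∧ (∀ e ∈ l, 0 ≤ d (tgt e)) ∧ 0 ≤ d r ∧
      ∀ q, 0 < d q → ∃ e ∈ l, tgt e = q ∧ 0 ≤ d (src e) ∧ d q = d (src e) + 1 := by
  classical
  induction l using List.reverseRecOn generalizing r with
  | nil =>
    obtain rfl : p = r := h
    refine ⟨fun q => if q = p then 0 else -1, ?_, by simp, by simp, ?_⟩
    · intro q; by_cases hq : q = p <;> simp [hq]
    · intro q; by_cases hq : q = p <;> simp [hq]
  | append_singleton l e ih =>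
    obtain ⟨q, hq, rfl, rfl⟩ := isPath_append.1 h
    obtain ⟨d, h₁, h₂, h₃, h₄⟩ := ih hq
    -- If the last edge ends in a visited vertex, the depths stay. Otherwise its target becomes a
    -- child of its source, and no other depth changes.
    by_cases he : 0 ≤ d (tgt e)
    · refine ⟨d, h₁, ?_, he, ?_⟩
      · intro e' he'
        rcases List.mem_append.1 he' with he' | he'
        · exact h₂ _ he'
        · rwa [List.mem_singleton.1 he']
      · intro q hq
        obtain ⟨e', he', h⟩ := h₄ q hq
        exact ⟨e', by simp [he'], h⟩
    · have hne (q) (hq : 0 ≤ d q) : q ≠ tgt e := by rintro rfl; exact he hq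
      have hp : p ≠ tgt e := hne _ ((h₁ p).2 rfl).ge
      have hd : 0 ≤ Function.update d (tgt e) (d (src e) + 1) (tgt e) := by
        rw [Function.update_self]; omega
      refine ⟨Function.update d (tgt e) (d (src e) + 1), ?_, ?_, hd, ?_⟩
      · intro q
        by_cases hq : q = tgt e
        · subst hq
          rw [Function.update_self]
          exact ⟨fun h => by omega, fun h => (hp h.symm).elim⟩
        · rw [Function.update_of_ne hq, h₁]
      · intro e' he'
        rcases List.mem_append.1 he' with he' | he'
        · rw [Function.update_of_ne (hne _ (h₂ _ he'))]
          exact h₂ _ he'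
        · rwa [List.mem_singleton.1 he']
      · intro q hq
        by_cases hqe : q = tgt e
        · subst hqe
          refine ⟨e, by simp, rfl, ?_⟩
          rw [Function.update_of_ne (hne _ h₃), Function.update_self]
          exact ⟨h₃, rfl⟩
        · rw [Function.update_of_ne hqe] at hq ⊢
          obtain ⟨e', he', h₅, h₆, h₇⟩ := h₄ q hq
          refine ⟨e', by simp [he'], h₅, ?_⟩
          rw [Function.update_of_ne (hne _ h₆)]
          exact ⟨h₆, h₇⟩

/-! ### Models of the Parikh tag formula and accepting runs -/

namespace TagAutomaton

open LIATerm LIAFormula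

variable {T S V : Type*}

/-- `ρ` is an accepting run of `B` from `p` to `r`. -/
structure IsAcceptingRun (B : TagAutomaton T S) (p : S) (ρ : List (S × Finset T × S)) (r : S) :
    Prop where
  init : p ∈ B.init
  final : r ∈ B.final
  trans : ∀ δ ∈ ρ, δ ∈ B.trans
  path : IsPath (fun δ : S × Finset T × S => δ.1) (fun δ => δ.2.2) p ρ r

/-- The values `f` of the Parikh variables count the transitions and the tags of `ρ`. -/
structure CountsRun (B : TagAutomaton T S) (f : ParikhVar T S → ℤ)
    (ρ : List (S × Finset T × S)) : Prop where
  trans : ∀ δ ∈ B.trans, f (.trans δ) = occ (fun δ' => δ' = δ) ρ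
  tag : ∀ t ∈ B.tags, f (.tag t) = occ (fun δ => t ∈ δ.2.1) ρ

theorem eval_transSum (B : TagAutomaton T S) (ν : ParikhVar T S → V) (P) [DecidablePred P]
    (α : V → ℤ) : (B.transSum ν P).eval α = ∑ δ ∈ B.trans with P δ, α (ν (.trans δ)) := by
  rw [transSum, eval_sum, List.map_map, Finset.sum_map_toList]
  exact Finset.sum_congr (by congr!) fun _ _ => rfl

theorem CountsRun.eval_transSum {B : TagAutomaton T S} {ν : ParikhVar T S → V} {α : V → ℤ}
    {ρ : List (S × Finset T × S)} (h : B.CountsRun (α ∘ ν) ρ) (hρ : ∀ δ ∈ ρ, δ ∈ B.trans) (P) :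
    (B.transSum ν P).eval α = occ P ρ := by
  classical
  rw [TagAutomaton.eval_transSum, ← sum_occ_eq P B.trans ρ hρ]
  exact Finset.sum_congr rfl fun δ hδ => h.trans δ (Finset.mem_filter.1 hδ).1

open scoped Classical in
theorem holds_spanFormula {B : TagAutomaton T S} {ν : ParikhVar T S → V} {α : V → ℤ} {q : S} :
    (B.spanFormula ν q).holds α ↔
      (α (ν (.span q)) = 0 ↔ α (ν (.init q)) = 1) ∧
      (α (ν (.span q)) ≤ -1 → α (ν (.init q)) = 0 ∧
        ∀ δ ∈ B.trans, δ.2.2 = q → α (ν (.trans δ)) = 0) ∧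
      (0 < α (ν (.span q)) → ∃ δ ∈ B.trans, δ.2.2 = q ∧ 0 < α (ν (.trans δ)) ∧
        0 ≤ α (ν (.span δ.1)) ∧ α (ν (.span q)) = α (ν (.span δ.1)) + 1) := by
  simp only [spanFormula, holds, holds_iff, holds_imp, holds_conj, holds_disj, List.mem_map,
    Finset.mem_toList, and_imp, forall_exists_index, forall_apply_eq_imp_iff₂, exists_exists_and_eq_and]
  simp only [holds_lt, eval, Finset.mem_filter, and_imp, and_assoc]

variable [Fintype S]

-- Integers between 0 and 1 with sum 1 are the indicator of a single state.
open scoped Classical in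
theorem holds_initFormula {B : TagAutomaton T S} {ν : ParikhVar T S → V} {α : V → ℤ} :
    (B.initFormula ν).holds α ↔ ∃ p ∈ B.init, ∀ q, α (ν (.init q)) = if q = p then 1 else 0 := by
  have hsum : (LIATerm.sum (B.init.toList.map fun q => var (ν (.init q)))).eval α =
      ∑ q ∈ B.init, α (ν (.init q)) := by
    rw [eval_sum, List.map_map, Finset.sum_map_toList]
    rfl
  simp only [initFormula, holds, holds_conj, List.mem_map, Finset.mem_toList, hsum, eval,
    forall_exists_index, and_imp, forall_apply_eq_imp_iff₂, Finset.mem_sdiff, Finset.mem_univ,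
    true_and]
  constructor
  · rintro ⟨h₁, h₂, h₃⟩
    obtain ⟨p, hp, hp0⟩ : ∃ p ∈ B.init, α (ν (.init p)) ≠ 0 := by
      by_contra! hcon
      rw [Finset.sum_eq_zero hcon] at h₃
      exact zero_ne_one h₃
    have hp1 : α (ν (.init p)) = 1 := by
      have := h₁ p hp
      omega
    refine ⟨p, hp, fun q => ?_⟩
    split_ifs with hq
    · rw [hq, hp1]
    · by_cases hqi : q ∈ B.init
      · rw [← Finset.add_sum_erase _ _ hp, hp1] at h₃
        have hz : ∑ q ∈ B.init.erase p, α (ν (.init q)) = 0 := by omega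
        exact (Finset.sum_eq_zero_iff_of_nonneg
          fun q hq => (h₁ q (Finset.mem_of_mem_erase hq)).1).1 hz q (Finset.mem_erase.2 ⟨hq, hqi⟩)
      · exact h₂ q hqi
  · rintro ⟨p, hp, h⟩
    simp only [h]
    refine ⟨fun q _ => ?_, fun q hq => ?_, ?_⟩
    · split_ifs <;> simp
    · rw [if_neg]
      rintro rfl
      exact hq hp
    · simp [hp]

open scoped Classical in
theorem holds_finalFormula {B : TagAutomaton T S} {ν : ParikhVar T S → V} {α : V → ℤ} :
    (B.finalFormula ν).holds α ↔
      (∀ q ∈ B.final, 0 ≤ α (ν (.final q)) ∧ α (ν (.final q)) ≤ 1) ∧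
        ∀ q ∉ B.final, α (ν (.final q)) = 0 := by
  simp only [finalFormula, holds, holds_conj, List.mem_map, Finset.mem_toList, eval,
    forall_exists_index, and_imp, forall_apply_eq_imp_iff₂, Finset.mem_sdiff, Finset.mem_univ,
    true_and]

open scoped Classical in
theorem holds_parikhTagFormula {B : TagAutomaton T S} {ν : ParikhVar T S → V} {α : V → ℤ} :
    (B.parikhTagFormula ν).holds α ↔
      (B.initFormula ν).holds α ∧ (B.finalFormula ν).holds α ∧
      (∀ q, α (ν (.init q)) + ∑ δ ∈ B.trans with δ.2.2 = q, α (ν (.trans δ)) =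
        α (ν (.final q)) + ∑ δ ∈ B.trans with δ.1 = q, α (ν (.trans δ))) ∧
      (∀ q, (B.spanFormula ν q).holds α) ∧
      (∀ δ ∈ B.trans, 0 ≤ α (ν (.trans δ))) ∧
      ∀ t ∈ B.tags, α (ν (.tag t)) = ∑ δ ∈ B.trans with t ∈ δ.2.1, α (ν (.trans δ)) := by
  simp only [parikhTagFormula, parikhFormula, kirchhoffFormula, holds, holds_conj, List.mem_map,
    Finset.mem_toList, eval, eval_transSum, forall_exists_index, and_imp,
    forall_apply_eq_imp_iff₂, Finset.mem_univ, true_imp_iff, forall_apply_eq_imp_iff,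
    forall_and, and_assoc]

open scoped Classical in
/-- Every model of the Parikh tag formula is the Parikh image of an accepting run. -/
theorem exists_run_of_holds {B : TagAutomaton T S} {ν : ParikhVar T S → V} {α : V → ℤ}
    (h : (B.parikhTagFormula ν).holds α) :
    ∃ p ρ r, B.IsAcceptingRun p ρ r ∧ B.CountsRun (α ∘ ν) ρ := by
  obtain ⟨hI, hF, hK, hσ, hpos, htag⟩ := holds_parikhTagFormula.1 h
  obtain ⟨p, hp, hI⟩ := holds_initFormula.1 hI
  obtain ⟨hF₁, hF₂⟩ := holds_finalFormula.1 hF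
  simp only [holds_spanFormula] at hσ
  -- The formula does not prescribe the sum of the final indicators. Summing Kirchhoff's law over
  -- all states cancels the transitions and shows that it equals the sum of the initial ones, which
  -- is 1.
  obtain ⟨r, hr, hF⟩ : ∃ r ∈ B.final, ∀ q, α (ν (.final q)) = if q = r then 1 else 0 := by
    have hsum := Finset.sum_congr rfl (s₁ := Finset.univ) fun q _ => hK q
    have hfib (f : S × Finset T × S → S) :
        ∑ q, ∑ δ ∈ B.trans with f δ = q, α (ν (.trans δ)) = ∑ δ ∈ B.trans, α (ν (.trans δ)) :=
      Finset.sum_fiberwise _ _ _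
    rw [Finset.sum_add_distrib, Finset.sum_add_distrib, hfib, hfib, add_left_inj] at hsum
    simp only [hI, Finset.sum_ite_eq', Finset.mem_univ, if_true] at hsum
    have hnn (q) : 0 ≤ α (ν (.final q)) := by
      by_cases hq : q ∈ B.final
      · exact (hF₁ q hq).1
      · exact (hF₂ q hq).ge
    obtain ⟨r, hr⟩ : ∃ r, α (ν (.final r)) ≠ 0 := by
      by_contra! hcon
      rw [Finset.sum_eq_zero fun q _ => hcon q] at hsum
      exact one_ne_zero hsum
    have hrF : r ∈ B.final := by
      by_contra hcon
      exact hr (hF₂ r hcon)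
    have hr1 : α (ν (.final r)) = 1 := by
      have := hF₁ r hrF
      omega
    refine ⟨r, hrF, fun q => ?_⟩
    split_ifs with hq
    · rw [hq, hr1]
    · rw [← Finset.add_sum_erase _ _ (Finset.mem_univ r), hr1] at hsum
      have hz : ∑ q ∈ Finset.univ.erase r, α (ν (.final q)) = 0 := by omega
      exact (Finset.sum_eq_zero_iff_of_nonneg fun q _ => hnn q).1 hz q
        (Finset.mem_erase.2 ⟨hq, Finset.mem_univ q⟩)
  set M : Multiset (S × Finset T × S) :=
    ∑ δ ∈ B.trans, Multiset.replicate (α (ν (.trans δ))).toNat δ with hM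
  have hcount (P : S × Finset T × S → Prop) [DecidablePred P] :
      (M.countP P : ℤ) = ∑ δ ∈ B.trans with P δ, α (ν (.trans δ)) := by
    rw [hM, ← Multiset.coe_countPAddMonoidHom, map_sum, Nat.cast_sum, Finset.sum_filter]
    refine Finset.sum_congr rfl fun δ hδ => ?_
    rw [Multiset.coe_countPAddMonoidHom, ← Multiset.coe_replicate, Multiset.coe_countP,
      List.countP_replicate]
    split_ifs with h₁ h₂ h₂
    · exact Int.toNat_of_nonneg (hpos δ hδ)
    · simp at h₁; exact (h₂ h₁).elim
    · simp at h₁; exact (h₁ h₂).elim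
    · rfl
  have hmem (δ) : δ ∈ M ↔ δ ∈ B.trans ∧ 0 < α (ν (.trans δ)) := by
    rw [hM, Multiset.mem_sum]
    simp only [Multiset.mem_replicate]
    constructor
    · rintro ⟨δ', hδ', h₁, rfl⟩
      exact ⟨hδ', by omega⟩
    · rintro ⟨h₁, h₂⟩
      exact ⟨δ, h₁, by omega, rfl⟩
  have hbal : IsBalanced (fun δ : S × Finset T × S => δ.1) (fun δ => δ.2.2) M p r := by
    refine isBalanced_of_forall_eq fun q => ?_
    have := hK q
    rw [← hcount, ← hcount, hI, hF] at this
    push_cast [← @Nat.cast_inj ℤ]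
    linarith
  obtain ⟨ρ, hρ, hpath⟩ := hbal.exists_eulerian (by
    intro W hpW hW
    -- Induction on the depth: a state of positive depth has a used incoming transition from a state
    -- whose depth is one less.
    have key (n : ℕ) : ∀ q, α (ν (.span q)) = n → q ∈ W := by
      induction n with
      | zero =>
        intro q hq
        have := (hσ q).1.1 (by simpa using hq)
        rw [hI] at this
        split_ifs at this with hqp
        · exact hqp ▸ hpW
        · exact (zero_ne_one this).elim
      | succ n ih =>
        intro q hq
        obtain ⟨δ, hδ, rfl, h₁, h₂, h₃⟩ := (hσ q).2.2 (by rw [hq]; positivity)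
        refine hW δ ((hmem δ).2 ⟨hδ, h₁⟩) (ih _ ?_)
        push_cast at hq
        omega
    intro δ hδ
    obtain ⟨hδ, hδ0⟩ := (hmem δ).1 hδ
    refine key (α (ν (.span δ.1))).toNat _ (Int.toNat_of_nonneg ?_).symm
    -- A state of negative depth is not initial and has no inflow, so Kirchhoff's law forbids
    -- outflow. The source of a used transition thus has nonnegative depth.
    by_contra! hneg
    obtain ⟨h₁, h₂⟩ := (hσ δ.1).2.1 (by omega)
    have h₃ := hK δ.1
    rw [h₁, Finset.sum_eq_zero (fun e he => h₂ e (Finset.mem_filter.1 he).1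
      (Finset.mem_filter.1 he).2)] at h₃
    have h₄ : α (ν (.trans δ)) ≤ ∑ e ∈ B.trans with e.1 = δ.1, α (ν (.trans e)) :=
      Finset.single_le_sum (f := fun e => α (ν (.trans e)))
        (fun e he => hpos e (Finset.mem_filter.1 he).1) (Finset.mem_filter.2 ⟨hδ, rfl⟩)
    have h₅ : 0 ≤ α (ν (.final δ.1)) := by rw [hF]; split_ifs <;> simp
    omega)
  refine ⟨p, ρ, r, ⟨hp, hr, fun δ hδ => ?_, hpath⟩, fun δ hδ => ?_, fun t ht => ?_⟩
  · exact ((hmem δ).1 (hρ ▸ Multiset.mem_coe.2 hδ)).1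
  · have h₁ := hcount (fun e => e = δ)
    rw [← hρ, Multiset.coe_countP, ← occ_eq_countP] at h₁
    rw [h₁, Finset.sum_filter, Finset.sum_ite_eq' B.trans δ fun e => α (ν (.trans e)), if_pos hδ]
    rfl
  · have h₁ := hcount (fun e => t ∈ e.2.1)
    rw [← hρ, Multiset.coe_countP, ← occ_eq_countP] at h₁
    rw [h₁]
    exact htag t ht

open scoped Classical in
/-- The Parikh image of an accepting run is a model of the Parikh tag formula. -/
theorem IsAcceptingRun.exists_values {B : TagAutomaton T S} {p r : S}
    {ρ : List (S × Finset T × S)} (h : B.IsAcceptingRun p ρ r) :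
    ∃ f : ParikhVar T S → ℤ, B.CountsRun f ρ ∧
      ∀ {V : Type _} (ν : ParikhVar T S → V) (α : V → ℤ), (∀ x ∈ B.parikhVars, α (ν x) = f x) →
        (B.parikhTagFormula ν).holds α := by
  obtain ⟨d, h₁, h₂, h₃, h₄⟩ := h.path.exists_depth
  -- The values are chosen before the assignment `α`, which need only agree with them on
  -- `parikhVars`, because the existential block of the formula binds no other variables.
  let f : ParikhVar T S → ℤ
    | .trans δ => occ (fun δ' => δ' = δ) ρ
    | .tag t => occ (fun δ => t ∈ δ.2.1) ρ
    | .init q => if q = p then 1 else 0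
    | .final q => if q = r then 1 else 0
    | .span q => d q
  refine ⟨f, ⟨fun _ _ => rfl, fun _ _ => rfl⟩, fun {V} ν α hα => ?_⟩
  have hi (q) : α (ν (.init q)) = if q = p then 1 else 0 := hα _ (by simp [parikhVars])
  have hf (q) : α (ν (.final q)) = if q = r then 1 else 0 := hα _ (by simp [parikhVars])
  have hs (q) : α (ν (.span q)) = d q := hα _ (by simp [parikhVars])
  have ht (δ) (hδ : δ ∈ B.trans) : α (ν (.trans δ)) = occ (fun δ' => δ' = δ) ρ :=
    hα _ (by simp [parikhVars, hδ])
  have hg (t) (ht : t ∈ B.tags) : α (ν (.tag t)) = occ (fun δ => t ∈ δ.2.1) ρ :=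
    hα _ (by simp [parikhVars, ht])
  have hsum (P : S × Finset T × S → Prop) [DecidablePred P] :
      ∑ δ ∈ B.trans with P δ, α (ν (.trans δ)) = occ P ρ := by
    rw [← sum_occ_eq P B.trans ρ h.trans]
    exact Finset.sum_congr rfl fun δ hδ => ht δ (Finset.mem_filter.1 hδ).1
  refine holds_parikhTagFormula.2 ⟨holds_initFormula.2 ⟨p, h.init, hi⟩,
    holds_finalFormula.2 ⟨fun q _ => ?_, fun q hq => ?_⟩, fun q => ?_, fun q => ?_,
    fun δ hδ => ?_, fun t ht => ?_⟩
  · rw [hf]; split_ifs <;> simp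
  · rw [hf, if_neg]; rintro rfl; exact hq h.final
  · rw [hsum, hsum, hi, hf]
    have := h.path.balanced (fun s => s = q)
    simp only [Multiset.coe_countP, ← occ_eq_countP, eq_comm (a := p), eq_comm (a := r)] at this
    zify at this
    linarith
  · refine holds_spanFormula.2 ⟨?_, fun hq => ⟨?_, fun δ hδ hδq => ?_⟩, fun hq => ?_⟩
    · rw [hs, hi, h₁]; split_ifs with hq <;> simp [hq]
    · rw [hi, if_neg]
      rintro rfl
      rw [hs, (h₁ q).2 rfl] at hq
      omega
    · rw [ht δ hδ, Nat.cast_eq_zero, occ_eq_zero]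
      rintro e he rfl
      have := h₂ e he
      rw [hδq, ← hs] at this
      omega
    · rw [hs] at hq
      obtain ⟨e, he, rfl, h₅, h₆⟩ := h₄ q hq
      refine ⟨e, h.trans e he, rfl, ?_, by rwa [hs], by rw [hs, hs, h₆]⟩
      rw [ht e (h.trans e he), Nat.cast_pos, occ_pos]
      exact ⟨e, he, rfl⟩
  · rw [ht δ hδ]; positivity
  · rw [hg t ht, hsum]

end TagAutomaton

/-! ### Runs of the automata of a `¬contains` constraint -/

namespace NFA

variable {A Q : Type*}

/-- `ρ` is a path of transitions of `M` from an initial to an accepting state. -/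
def IsAcceptingPath (M : NFA A Q) (ρ : List (Q × A × Q)) : Prop :=
  ∃ s ∈ M.start, ∃ e ∈ M.accept, (∀ t ∈ ρ, t.2.2 ∈ M.step t.1 t.2.1) ∧
    IsPath (fun t : Q × A × Q => t.1) (fun t => t.2.2) s ρ e

theorem IsAcceptingPath.isRun {M : NFA A Q} {ρ : List (Q × A × Q)} (h : M.IsAcceptingPath ρ) :
    M.IsRun ρ := by
  obtain ⟨s, hs, e, -, hρ, hp⟩ := h
  refine ⟨hρ, ?_, ?_⟩
  · cases ρ with
    | nil => simp
    | cons t ρ => simpa [hp.1] using hs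
  · clear hs hρ
    induction ρ generalizing s with
    | nil => exact .nil
    | cons t ρ ih =>
      refine List.isChain_cons.2 ⟨?_, ih _ hp.2⟩
      cases ρ with
      | nil => simp
      | cons t' ρ => simpa using hp.2.1.symm

/-- Replaces words by lists of transitions, the objects that flatness and Parikh images refer to. -/
theorem mem_accepts_iff {M : NFA A Q} {w : List A} :
    w ∈ M.accepts ↔ ∃ ρ, M.IsAcceptingPath ρ ∧ ρ.map (fun t => t.2.1) = w := by
  have key (e : Q) (w : List A) : ∀ s, Nonempty (M.Path s e w) ↔
      ∃ ρ : List (Q × A × Q), (∀ t ∈ ρ, t.2.2 ∈ M.step t.1 t.2.1) ∧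
        IsPath (fun t : Q × A × Q => t.1) (fun t => t.2.2) s ρ e ∧
          ρ.map (fun t => t.2.1) = w := by
    induction w with
    | nil =>
      intro s
      constructor
      · rintro ⟨⟨⟩⟩
        exact ⟨[], by simp, rfl, rfl⟩
      · rintro ⟨ρ, -, hp, h⟩
        obtain rfl := List.map_eq_nil_iff.1 h
        obtain rfl : s = e := hp
        exact ⟨.nil s⟩
    | cons a w ih =>
      intro s
      constructor
      · rintro ⟨hp⟩
        cases hp with | cons t _ _ _ _ ht hpath
        obtain ⟨ρ, h₁, h₂, h₃⟩ := (ih t).1 ⟨hpath⟩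
        exact ⟨(s, a, t) :: ρ, List.forall_mem_cons.2 ⟨ht, h₁⟩, ⟨rfl, h₂⟩, by simp [h₃]⟩
      · rintro ⟨_ | ⟨⟨s', a', t⟩, ρ⟩, h₁, h₂, h₃⟩
        · simp at h₃
        · obtain ⟨rfl, h₂⟩ := h₂
          obtain ⟨h₀, h₁⟩ := List.forall_mem_cons.1 h₁
          rw [List.map_cons, List.cons.injEq] at h₃
          obtain ⟨rfl, h₃⟩ := h₃
          obtain ⟨hpath⟩ := (ih t).2 ⟨ρ, h₁, h₂, h₃⟩
          exact ⟨.cons t _ _ _ _ h₀ hpath⟩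
  rw [accepts_iff_exists_path]
  simp only [key, IsAcceptingPath]
  constructor
  · rintro ⟨s, hs, e, he, ρ, h₁, h₂, h₃⟩
    exact ⟨ρ, ⟨s, hs, e, he, h₁, h₂⟩, h₃⟩
  · rintro ⟨ρ, ⟨s, hs, e, he, h₁, h₂⟩, h₃⟩
    exact ⟨s, hs, e, he, ρ, h₁, h₂, h₃⟩

end NFA

/-! ### Steps of the concatenated automaton and transitions of its three copies -/

namespace NotContains

/-- A step of the concatenation of the automata with state sets `Q x`: reading a letter in the
automaton of `x`, or passing to the next automaton. -/
inductive Step {X : Type*} (A : Type*) (Q : X → Type*) where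
  | letter (x : X) (q : Q x) (a : A) (r : Q x) : Step A Q
  | eps (p r : Σ x, Q x) : Step A Q

namespace Step

variable {A X : Type*} {Q : X → Type*}

def src : Step A Q → Σ x, Q x
  | letter x q _ _ => ⟨x, q⟩
  | eps p _ => p

def tgt : Step A Q → Σ x, Q x
  | letter x _ _ r => ⟨x, r⟩
  | eps _ r => r

/-- The step is a transition of one of the automata or leads from one to the next. -/
def Valid [LinearOrder X] (aut : ∀ x, NFA A (Q x)) : Step A Q → Prop
  | letter x q a r => r ∈ (aut x).step q a
  | eps p r => p.1 ⋖ r.1 ∧ p.2 ∈ (aut p.1).accept ∧ r.2 ∈ (aut r.1).start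

open scoped Classical in
noncomputable def toTrans : Step A Q → (Σ x, Q x) × Finset (Tag A X) × (Σ x, Q x)
  | letter x q a r => (⟨x, q⟩, {.sym a, .len x}, ⟨x, r⟩)
  | eps p r => (p, ∅, r)

/-- The position tag of the copy `i`. -/
def posTag (i : Fin 3) (x : X) : Tag A X :=
  ![.pos₁ x, .pos₂ x, .pos₃ x] i

open scoped Classical in
/-- The transition of `threeCopies` for a step within one of the copies. -/
noncomputable def lift (i : Fin 3) : Step A Q →
    ((Σ x, Q x) × Fin 3) × Finset (Tag A X) × ((Σ x, Q x) × Fin 3)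
  | letter x q a r => ((⟨x, q⟩, i), {.sym a, posTag i x, .len x}, (⟨x, r⟩, i))
  | eps p r => ((p, i), ∅, (r, i))

open scoped Classical in
/-- The transition of `threeCopies` that samples the first mismatch. -/
noncomputable def mark₁ (x : X) (q : Q x) (a : A) (r : Q x) :
    ((Σ x, Q x) × Fin 3) × Finset (Tag A X) × ((Σ x, Q x) × Fin 3) :=
  ((⟨x, q⟩, 0), {.sym a, .mis₁ a x, .pos₂ x, .len x}, (⟨x, r⟩, 1))

open scoped Classical in
/-- The transition of `threeCopies` that samples the second mismatch. -/
noncomputable def mark₂ (x : X) (q : Q x) (a : A) (r : Q x) :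
    ((Σ x, Q x) × Fin 3) × Finset (Tag A X) × ((Σ x, Q x) × Fin 3) :=
  ((⟨x, q⟩, 1), {.sym a, .mis₂ a x, .pos₃ x, .len x}, (⟨x, r⟩, 2))

theorem lift_fst (i : Fin 3) (s : Step A Q) : (s.lift i).1 = (s.src, i) := by
  cases s <;> rfl

theorem lift_snd_snd (i : Fin 3) (s : Step A Q) : (s.lift i).2.2 = (s.tgt, i) := by
  cases s <;> rfl

open scoped Classical in
/-- The transition of the automaton of `x` in a step. -/
noncomputable def transOf (x : X) : Step A Q → Option (Q x × A × Q x)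
  | letter y q a r => if h : y = x then some (h ▸ (q, a, r)) else none
  | eps _ _ => none

theorem transOf_self (x : X) (q : Q x) (a : A) (r : Q x) :
    (letter x q a r).transOf x = some (q, a, r) := by
  simp [transOf]

theorem transOf_ne {x y : X} (h : y ≠ x) (q : Q y) (a : A) (r : Q y) :
    (letter y q a r).transOf x = none := by
  simp [transOf, h]

theorem transOf_eps (x : X) (p r : Σ x, Q x) : (eps p r : Step A Q).transOf x = none := rfl

theorem transOf_eq_some {x : X} {s : Step A Q} {t : Q x × A × Q x} :
    s.transOf x = some t ↔ s = letter x t.1 t.2.1 t.2.2 := by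
  constructor
  · cases s with
    | eps p r => simp [transOf_eps]
    | letter y q a r =>
      by_cases h : y = x
      · subst h
        rw [transOf_self]
        rintro ⟨⟩
        rfl
      · simp [transOf_ne h]
  · rintro rfl
    rw [transOf_self]

end Step

section Mem

variable {A X : Type*} [Fintype A] [Fintype X] [LinearOrder X] {Q : X → Type*}
  [∀ x, Fintype (Q x)] (aut : ∀ x, NFA A (Q x))

/-- The `ε`-concatenation of the automata of all variables. -/
noncomputable abbrev concatAut : TagAutomaton (Tag A X) (Σ x, Q x) :=
  epsConcat fun x => lenTag x (aut x)

variable {aut}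

theorem mem_concatAut_trans {δ} : δ ∈ (concatAut aut).trans ↔
    ∃ s : Step A Q, s.Valid aut ∧ δ = s.toTrans := by
  classical
  simp only [epsConcat, lenTag, Finset.mem_union, Finset.mem_biUnion, Finset.mem_univ, true_and,
    Finset.mem_image, Finset.mem_filter]
  constructor
  · rintro (⟨x, _, ⟨⟨q, a, r⟩, ht, rfl⟩, rfl⟩ | ⟨⟨p, r⟩, h, rfl⟩)
    · exact ⟨.letter x q a r, ht, by simp [Step.toTrans]⟩
    · exact ⟨.eps p r, h, rfl⟩
  · rintro ⟨_ | ⟨p, r⟩, hs, rfl⟩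
    · rename_i x q a r
      exact .inl ⟨x, _, ⟨(q, a, r), hs, rfl⟩, by simp [Step.toTrans]⟩
    · exact .inr ⟨(p, r), hs, rfl⟩

theorem mem_letterTrans {a : A} {z : X} {δ} : δ ∈ letterTrans (concatAut aut) a z ↔
    ∃ q r, r ∈ (aut z).step q a ∧ δ = (Step.letter z q a r).toTrans := by
  classical
  rw [letterTrans, Finset.mem_filter, mem_concatAut_trans]
  constructor
  · rintro ⟨⟨_ | ⟨p, r⟩, hs, rfl⟩, h⟩
    · rename_i x q b r
      simp only [Step.toTrans] at h
      -- Equal tag sets contain the same symbol tag and the same length tag, so the letter and the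
      -- variable can be read off.
      have h₁ : Tag.sym b ∈ ({.sym a, .len z} : Finset (Tag A X)) := h ▸ by simp
      have h₂ : Tag.len x ∈ ({.sym a, .len z} : Finset (Tag A X)) := h ▸ by simp
      simp only [Finset.mem_insert, Finset.mem_singleton, Tag.sym.injEq, Tag.len.injEq,
        reduceCtorEq, or_false, false_or] at h₁ h₂
      subst h₁ h₂
      exact ⟨q, r, hs, rfl⟩
    · simp [Step.toTrans, eq_comm (a := (∅ : Finset _))] at h
  · rintro ⟨q, r, hs, rfl⟩
    exact ⟨⟨.letter z q a r, hs, rfl⟩, by simp [Step.toTrans]⟩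

theorem mem_threeCopies_trans {δ} : δ ∈ (threeCopies (concatAut aut)).trans ↔
    (∃ s : Step A Q, s.Valid aut ∧ ∃ i, δ = s.lift i) ∨
      ∃ x q a r, r ∈ (aut x).step q a ∧ (δ = Step.mark₁ x q a r ∨ δ = Step.mark₂ x q a r) := by
  classical
  simp only [threeCopies, Finset.mem_union, Finset.mem_biUnion, Finset.mem_univ, true_and,
    mem_letterTrans, Finset.mem_image, Finset.mem_filter, mem_concatAut_trans]
  constructor
  · rintro (⟨⟨a, x⟩, _, ⟨q, r, h, rfl⟩, hδ⟩ | ⟨_, ⟨⟨s, hs, rfl⟩, hs'⟩, i, rfl⟩)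
    · simp only [Step.toTrans, Finset.mem_insert, Finset.mem_singleton] at hδ
      rcases hδ with hδ | hδ | hδ | hδ | hδ
      · exact .inl ⟨.letter x q a r, h, 0, by rw [hδ]; simp [Step.lift, Step.posTag]⟩
      · exact .inr ⟨x, q, a, r, h, .inl (by rw [hδ]; simp [Step.mark₁])⟩
      · exact .inl ⟨.letter x q a r, h, 1, by rw [hδ]; simp [Step.lift, Step.posTag]⟩
      · exact .inr ⟨x, q, a, r, h, .inr (by rw [hδ]; simp [Step.mark₂])⟩
      · exact .inl ⟨.letter x q a r, h, 2, by rw [hδ]; simp [Step.lift, Step.posTag]⟩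
    · cases s with
      | letter x q a r => simp [Step.toTrans] at hs'
      | eps p r => exact .inl ⟨.eps p r, hs, i, rfl⟩
  · rintro (⟨s, hs, i, rfl⟩ | ⟨x, q, a, r, h, rfl | rfl⟩)
    · cases s with
      | letter x q a r =>
        refine .inl ⟨(a, x), _, ⟨q, r, hs, rfl⟩, ?_⟩
        simp only [Step.toTrans, Finset.mem_insert, Finset.mem_singleton]
        fin_cases i
        · left; simp [Step.lift, Step.posTag]
        · right; right; left; simp [Step.lift, Step.posTag]
        · right; right; right; right; simp [Step.lift, Step.posTag]
      | eps p r =>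
        exact .inr ⟨_, ⟨⟨.eps p r, hs, rfl⟩, rfl⟩, i, rfl⟩
    · refine .inl ⟨(a, x), _, ⟨q, r, h, rfl⟩, ?_⟩
      simp only [Step.toTrans, Finset.mem_insert, Finset.mem_singleton]
      right; left; simp [Step.mark₁]
    · refine .inl ⟨(a, x), _, ⟨q, r, h, rfl⟩, ?_⟩
      simp only [Step.toTrans, Finset.mem_insert, Finset.mem_singleton]
      right; right; right; left; simp [Step.mark₂]

/-- A variable is required for the symbol tags, which come from the automata of the single
variables. -/
theorem mem_threeCopies_tags [Nonempty X] (t : Tag A X) :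
    t ∈ (threeCopies (concatAut aut)).tags := by
  classical
  cases t <;> simp [threeCopies, epsConcat, lenTag]

end Mem

end NotContains

/-! ### Cutting a path of the concatenation into paths of the single automata -/

namespace NotContains

open Step

/-- The part of a path in the concatenation that lies in the automaton of `x`. -/
noncomputable def piece {A X : Type*} {Q : X → Type*} (x : X) (σ : List (Step A Q)) :
    List (Q x × A × Q x) :=
  σ.filterMap (transOf x)

section Piece

variable {A X : Type*} {Q : X → Type*}

@[simp] theorem piece_nil (x : X) : piece x ([] : List (Step A Q)) = [] := rfl

theorem piece_append (x : X) (σ τ : List (Step A Q)) :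
    piece x (σ ++ τ) = piece x σ ++ piece x τ := List.filterMap_append

theorem piece_cons_self (x : X) (q : Q x) (a : A) (r : Q x) (σ : List (Step A Q)) :
    piece x (letter x q a r :: σ) = (q, a, r) :: piece x σ := by
  simp [piece, transOf_self]

theorem piece_cons_ne {x y : X} (h : y ≠ x) (q : Q y) (a : A) (r : Q y) (σ : List (Step A Q)) :
    piece x (letter y q a r :: σ) = piece x σ := by
  simp [piece, transOf_ne h]

theorem piece_cons_eps (x : X) (p r : Σ x, Q x) (σ : List (Step A Q)) :
    piece x (eps p r :: σ) = piece x σ := by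
  simp [piece, List.filterMap_cons, transOf_eps]

open scoped Classical in
theorem length_piece_cons (x y : X) (q : Q y) (a : A) (r : Q y) (σ : List (Step A Q)) :
    (piece x (letter y q a r :: σ)).length = (if x = y then 1 else 0) + (piece x σ).length := by
  split_ifs with h
  · subst h
    rw [piece_cons_self, List.length_cons, add_comm]
  · rw [piece_cons_ne (Ne.symm h), zero_add]

/-- A path splits at the step that gives the transition at position `k` of a piece. -/
theorem exists_split_of_getElem?_piece {x : X} {σ : List (Step A Q)} {k : ℕ} {t : Q x × A × Q x}
    (h : (piece x σ)[k]? = some t) :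
    ∃ σ₁ σ₂, σ = σ₁ ++ letter x t.1 t.2.1 t.2.2 :: σ₂ ∧ (piece x σ₁).length = k := by
  obtain ⟨hk, ht⟩ := List.getElem?_eq_some_iff.1 h
  have hsplit : piece x σ = (piece x σ).take k ++ t :: (piece x σ).drop (k + 1) := by
    rw [← ht, List.getElem_cons_drop, List.take_append_drop]
  obtain ⟨σ₁, τ, rfl, h₁, h₂⟩ := List.filterMap_eq_append_iff.1 hsplit
  obtain ⟨τ₁, s, τ₂, rfl, hτ₁, hs, -⟩ := List.filterMap_eq_cons_iff.1 h₂
  -- The steps in `τ₁` lie outside the automaton of `x`, so they do not change the position `k`.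
  refine ⟨σ₁ ++ τ₁, τ₂, ?_, ?_⟩
  · rw [transOf_eq_some.1 hs]; simp
  · have : piece x τ₁ = [] := List.filterMap_eq_nil_iff.2 fun s hs => hτ₁ s hs
    rw [piece_append, this, List.append_nil]
    refine (congrArg List.length h₁).trans ?_
    rw [List.length_take]
    exact min_eq_left hk.le

theorem occ_piece (x : X) (t : Q x × A × Q x) (σ : List (Step A Q)) :
    occ (fun t' => t' = t) (piece x σ) = occ (fun s => s = letter x t.1 t.2.1 t.2.2) σ := by
  classical
  induction σ with
  | nil => rfl
  | cons s σ ih =>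
    cases s with
    | eps p r =>
      rw [piece_cons_eps, occ_cons, ih]
      simp
    | letter y q a r =>
      by_cases h : y = x
      · subst h
        rw [piece_cons_self, occ_cons, occ_cons, ih]
        simp [Prod.ext_iff]
      · rw [piece_cons_ne h, occ_cons, ih]
        simp [h]

variable [LinearOrder X] {aut : ∀ x, NFA A (Q x)}

theorem Step.Valid.src_le_tgt {s : Step A Q} (hs : s.Valid aut) : s.src.1 ≤ s.tgt.1 := by
  cases s with
  | letter x q a r => exact le_rfl
  | eps p r => exact hs.1.le

theorem path_le {p r : Σ x, Q x} {σ : List (Step A Q)} (hσ : ∀ s ∈ σ, s.Valid aut)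
    (h : IsPath Step.src Step.tgt p σ r) : p.1 ≤ r.1 := by
  induction σ generalizing p with
  | nil => exact (congrArg Sigma.fst h).le
  | cons s σ ih =>
    obtain ⟨h₁, h₂⟩ := List.forall_mem_cons.1 hσ
    exact h.1 ▸ h₁.src_le_tgt.trans (ih h₂ h.2)

/-- Variables never decrease along a path, so no automaton before the start or after the end is
visited. -/
theorem piece_eq_nil_of_lt {p r : Σ x, Q x} {σ : List (Step A Q)} (hσ : ∀ s ∈ σ, s.Valid aut)
    (h : IsPath Step.src Step.tgt p σ r) {z : X} (hz : z < p.1 ∨ r.1 < z) : piece z σ = [] := by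
  induction σ generalizing p with
  | nil => rfl
  | cons s σ ih =>
    obtain ⟨h₁, h₂⟩ := List.forall_mem_cons.1 hσ
    have hle := h₁.src_le_tgt
    obtain ⟨rfl, h⟩ := h
    have htl := ih h₂ h (hz.imp_left fun hz => hz.trans_le hle)
    cases s with
    | letter y q a r' =>
      rw [piece_cons_ne, htl]
      rintro rfl
      rcases hz with hz | hz
      · exact lt_irrefl _ hz
      · exact lt_irrefl _ (hz.trans_le (path_le h₂ h))
    | eps p r' => rwa [piece_cons_eps]

/-- The disjunctions allow paths that start or end inside the automaton of `z`, as the induction on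
the path requires. A path that starts earlier enters at an initial state, and one that ends later
leaves at an accepting state. -/
theorem path_piece {p r : Σ x, Q x} {σ : List (Step A Q)} (hσ : ∀ s ∈ σ, s.Valid aut)
    (h : IsPath Step.src Step.tgt p σ r) {z : X} (hpz : p.1 ≤ z) (hzr : z ≤ r.1) :
    ∃ s e, (p = ⟨z, s⟩ ∨ p.1 < z ∧ s ∈ (aut z).start) ∧
      (r = ⟨z, e⟩ ∨ z < r.1 ∧ e ∈ (aut z).accept) ∧
      (∀ t ∈ piece z σ, t.2.2 ∈ (aut z).step t.1 t.2.1) ∧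
      IsPath (fun t : Q z × A × Q z => t.1) (fun t => t.2.2) s (piece z σ) e := by
  induction σ generalizing p with
  | nil =>
    obtain rfl : p = r := h
    obtain ⟨y, q⟩ := p
    obtain rfl : y = z := le_antisymm hpz hzr
    exact ⟨q, q, .inl rfl, .inl rfl, by simp, rfl⟩
  | cons s σ ih =>
    obtain ⟨h₁, h₂⟩ := List.forall_mem_cons.1 hσ
    obtain ⟨rfl, h⟩ := h
    cases s with
    | letter y q a r' =>
      obtain ⟨s, e, hs, he, ht, hp⟩ := ih h₂ h hpz
      by_cases hyz : y = z
      · subst hyz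
        have hs : r' = s := by
          rcases hs with hs | hs
          · cases hs; rfl
          · exact (lt_irrefl _ hs.1).elim
        subst hs
        rw [piece_cons_self]
        exact ⟨q, e, .inl rfl, he, List.forall_mem_cons.2 ⟨h₁, ht⟩, rfl, hp⟩
      · rw [piece_cons_ne hyz]
        refine ⟨s, e, .inr ?_, he, ht, hp⟩
        rcases hs with hs | hs
        · exact (hyz (congrArg Sigma.fst hs)).elim
        · exact hs
    | eps p r' =>
      rw [piece_cons_eps]
      obtain ⟨hcov, hacc, hst⟩ := h₁
      -- Either the step leaves the automaton of `z` for good, or it starts below `z` and, leading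
      -- to an immediate successor, cannot jump over `z`.
      rcases eq_or_lt_of_le (show p.1 ≤ z from hpz) with rfl | hlt
      · have hnil := piece_eq_nil_of_lt h₂ h (z := p.1) (.inl hcov.lt)
        rw [hnil]
        exact ⟨p.2, p.2, .inl rfl, .inr ⟨hcov.lt.trans_le (path_le h₂ h), hacc⟩, by simp, rfl⟩
      · obtain ⟨s, e, hs, he, ht, hp⟩ := ih h₂ h (hcov.ge_of_gt hlt)
        refine ⟨s, e, .inr ⟨hlt, ?_⟩, he, ht, hp⟩
        rcases hs with hs | hs
        · change r' = _ at hs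
          rw [hs] at hst
          exact hst
        · exact hs.2

/-- The restrictions of an accepting path of the concatenation are accepting paths. -/
theorem isAcceptingPath_piece {p r : Σ x, Q x} {σ : List (Step A Q)}
    (hσ : ∀ s ∈ σ, s.Valid aut) (h : IsPath Step.src Step.tgt p σ r)
    (hp : IsBot p.1 ∧ p.2 ∈ (aut p.1).start) (hr : IsTop r.1 ∧ r.2 ∈ (aut r.1).accept) (z : X) :
    (aut z).IsAcceptingPath (piece z σ) := by
  obtain ⟨s, e, hs, he, ht, hpath⟩ := path_piece hσ h (hp.1 z) (hr.1 z)
  refine ⟨s, ?_, e, ?_, ht, hpath⟩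
  · rcases hs with rfl | hs
    · exact hp.2
    · exact hs.2
  · rcases he with rfl | he
    · exact hr.2
    · exact he.2

/-- Accepting paths of all automata combine to an accepting path of the concatenation. -/
theorem exists_path_of_isAcceptingPath [Finite X] [Nonempty X]
    {R : ∀ x, List (Q x × A × Q x)} (hR : ∀ x, (aut x).IsAcceptingPath (R x)) :
    ∃ (p : Σ x, Q x) (σ : List (Step A Q)) (r : Σ x, Q x), (∀ s ∈ σ, s.Valid aut) ∧
      IsPath Step.src Step.tgt p σ r ∧ (IsBot p.1 ∧ p.2 ∈ (aut p.1).start) ∧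
      (IsTop r.1 ∧ r.2 ∈ (aut r.1).accept) ∧ ∀ x, piece x σ = R x := by
  have hlift (x : X) : ∀ (ρ : List (Q x × A × Q x)) (s e : Q x),
      (∀ t ∈ ρ, t.2.2 ∈ (aut x).step t.1 t.2.1) →
      IsPath (fun t : Q x × A × Q x => t.1) (fun t => t.2.2) s ρ e →
      ∃ σ : List (Step A Q), (∀ s ∈ σ, s.Valid aut) ∧ IsPath Step.src Step.tgt ⟨x, s⟩ σ ⟨x, e⟩ ∧
        piece x σ = ρ ∧ ∀ z ≠ x, piece z σ = [] := by
    intro ρ s e hρ h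
    refine ⟨ρ.map fun t => letter x t.1 t.2.1 t.2.2, ?_,
      isPath_map (src' := Step.src) (tgt' := Step.tgt)
        (fun t : Q x × A × Q x => letter x t.1 t.2.1 t.2.2) (fun q => (⟨x, q⟩ : Σ x, Q x))
        (fun _ => rfl) (fun _ => rfl) h, ?_, ?_⟩
    · intro s hs
      obtain ⟨t, ht, rfl⟩ := List.mem_map.1 hs
      exact hρ t ht
    · simp [piece, List.filterMap_map, transOf_self]
    · intro z hz
      simp [piece, List.filterMap_map, transOf_ne hz.symm]
  choose s hs e he hρ hpath using hR
  choose σ hσ₁ hσ₂ hσ₃ hσ₄ using fun x => hlift x (R x) (s x) (e x) (hρ x) (hpath x)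
  obtain ⟨b, hb⟩ : ∃ b : X, IsBot b := by
    obtain ⟨b, hb⟩ := Finite.exists_min (id : X → X)
    exact ⟨b, hb⟩
  obtain ⟨t, ht⟩ : ∃ t : X, IsTop t := by
    obtain ⟨t, ht⟩ := Finite.exists_max (id : X → X)
    exact ⟨t, ht⟩
  -- The automata up to `y` are traversed by appending the path for `y` to the one built for its
  -- immediate predecessor.
  have key (y : X) : ∃ τ : List (Step A Q), (∀ s ∈ τ, s.Valid aut) ∧
      IsPath Step.src Step.tgt ⟨b, s b⟩ τ ⟨y, e y⟩ ∧ (∀ z ≤ y, piece z τ = R z) := by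
    induction y using WellFoundedLT.induction with
    | ind y ih =>
      by_cases hy : y = b
      · subst hy
        refine ⟨σ y, hσ₁ y, hσ₂ y, fun z hz => ?_⟩
        rw [le_antisymm hz (hb z), hσ₃]
      · obtain ⟨x, -, hxy⟩ := exists_le_covBy_of_lt (lt_of_le_of_ne (hb y) (Ne.symm hy))
        obtain ⟨τ, hτ₁, hτ₂, hτ₃⟩ := ih x hxy.lt
        have hpath : IsPath Step.src Step.tgt ⟨b, s b⟩
            (τ ++ eps ⟨x, e x⟩ ⟨y, s y⟩ :: σ y) ⟨y, e y⟩ :=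
          isPath_append.2 ⟨_, hτ₂, rfl, hσ₂ y⟩
        refine ⟨τ ++ eps ⟨x, e x⟩ ⟨y, s y⟩ :: σ y, ?_, hpath, fun z hz => ?_⟩
        · intro s' hs'
          rcases List.mem_append.1 hs' with h | h
          · exact hτ₁ _ h
          · rcases List.mem_cons.1 h with rfl | h
            · exact ⟨hxy, he x, hs y⟩
            · exact hσ₁ _ _ h
        · rw [piece_append, piece_cons_eps]
          rcases eq_or_lt_of_le hz with rfl | hlt
          · rw [piece_eq_nil_of_lt hτ₁ hτ₂ (.inr hxy.lt), hσ₃, List.nil_append]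
          · rw [hτ₃ z (hxy.le_of_lt hlt), hσ₄ y z hlt.ne, List.append_nil]
  obtain ⟨τ, hτ₁, hτ₂, hτ₃⟩ := key t
  exact ⟨_, τ, _, hτ₁, hτ₂, ⟨hb, hs b⟩, ⟨ht, he t⟩, fun x => hτ₃ x (ht x)⟩

end Piece

end NotContains

/-! ### Tag counts in unmarked and marked runs -/

namespace NotContains

open Step

section Runs

variable {A X : Type*} {Q : X → Type*}

/-- The transition is one of the copies of a letter step in `threeCopies`. -/
def IsCopyOf (x : X) (t : Q x × A × Q x)
    (δ : ((Σ x, Q x) × Fin 3) × Finset (Tag A X) × ((Σ x, Q x) × Fin 3)) : Prop :=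
  δ.1.1 = ⟨x, t.1⟩ ∧ δ.2.2.1 = ⟨x, t.2.2⟩ ∧ .sym t.2.1 ∈ δ.2.1

open scoped Classical in
theorem occ_len_lift (i : Fin 3) (x : X) (σ : List (Step A Q)) :
    occ (fun δ => Tag.len x ∈ δ.2.1) (σ.map (lift i)) = (piece x σ).length := by
  induction σ with
  | nil => rfl
  | cons s σ ih =>
    rw [List.map_cons, occ_cons, ih]
    cases s with
    | eps p r => simp [lift, piece_cons_eps]
    | letter y q a r =>
      rw [length_piece_cons]
      fin_cases i <;> simp [lift, posTag]

open scoped Classical in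
theorem occ_pos_lift (i j : Fin 3) (x : X) (σ : List (Step A Q)) :
    occ (fun δ => posTag j x ∈ δ.2.1) (σ.map (lift i)) =
      if i = j then (piece x σ).length else 0 := by
  induction σ with
  | nil => simp
  | cons s σ ih =>
    rw [List.map_cons, occ_cons, ih]
    cases s with
    | eps p r => simp [lift, piece_cons_eps]
    | letter y q a r =>
      rw [length_piece_cons]
      fin_cases i <;> fin_cases j <;> simp [lift, posTag]

open scoped Classical in
theorem occ_mis_lift (i : Fin 3) (t : Tag A X) (σ : List (Step A Q))
    (ht : ∃ a x, t = .mis₁ a x ∨ t = .mis₂ a x) :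
    occ (fun δ => t ∈ δ.2.1) (σ.map (lift i)) = 0 := by
  rw [occ_map, occ_eq_zero]
  rintro s -
  obtain ⟨a, x, rfl | rfl⟩ := ht <;> cases s <;> fin_cases i <;> simp [lift, posTag]

open scoped Classical in
theorem occ_isCopyOf_lift (i : Fin 3) (x : X) (t : Q x × A × Q x) (σ : List (Step A Q)) :
    occ (IsCopyOf x t) (σ.map (lift i)) = occ (fun t' => t' = t) (piece x σ) := by
  rw [occ_piece, occ_map]
  congr 1
  funext s
  cases s with
  | eps p r => simp [lift, IsCopyOf]
  | letter y q a r =>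
    obtain ⟨q', a', r'⟩ := t
    by_cases h : y = x
    · subst h
      fin_cases i <;> simp [lift, IsCopyOf, posTag] <;> tauto
    · simp [lift, IsCopyOf, h]

theorem isPath_map_lift {p r : Σ x, Q x} {σ : List (Step A Q)} (i : Fin 3)
    (h : IsPath Step.src Step.tgt p σ r) :
    IsPath (fun δ : ((Σ x, Q x) × Fin 3) × Finset (Tag A X) × ((Σ x, Q x) × Fin 3) => δ.1)
      (fun δ => δ.2.2) (p, i) (σ.map (lift i)) (r, i) :=
  isPath_map _ (fun q => (q, i)) (fun s => lift_fst i s) (fun s => lift_snd_snd i s) h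

/-- The run of `threeCopies` that samples mismatches at two letter steps. -/
noncomputable def markedRun (σ₁ : List (Step A Q)) (x₁ : X) (t₁ : Q x₁ × A × Q x₁)
    (σ₂ : List (Step A Q)) (x₂ : X) (t₂ : Q x₂ × A × Q x₂) (σ₃ : List (Step A Q)) :
    List (((Σ x, Q x) × Fin 3) × Finset (Tag A X) × ((Σ x, Q x) × Fin 3)) :=
  σ₁.map (lift 0) ++ mark₁ x₁ t₁.1 t₁.2.1 t₁.2.2 ::
    (σ₂.map (lift 1) ++ mark₂ x₂ t₂.1 t₂.2.1 t₂.2.2 :: σ₃.map (lift 2))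

/-- The path of the concatenation that underlies a marked run. -/
def unmarkedPath (σ₁ : List (Step A Q)) (x₁ : X) (t₁ : Q x₁ × A × Q x₁)
    (σ₂ : List (Step A Q)) (x₂ : X) (t₂ : Q x₂ × A × Q x₂) (σ₃ : List (Step A Q)) :
    List (Step A Q) :=
  σ₁ ++ letter x₁ t₁.1 t₁.2.1 t₁.2.2 :: (σ₂ ++ letter x₂ t₂.1 t₂.2.1 t₂.2.2 :: σ₃)

/-- The numbers of transitions and of letters in `ρ` are those of the paths `R x`. -/
structure Describes (ρ : List (((Σ x, Q x) × Fin 3) × Finset (Tag A X) × ((Σ x, Q x) × Fin 3)))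
    (R : ∀ x, List (Q x × A × Q x)) : Prop where
  len : ∀ x, occ (fun δ => Tag.len x ∈ δ.2.1) ρ = (R x).length
  copy : ∀ x t, occ (IsCopyOf x t) ρ = occ (fun t' => t' = t) (R x)

open scoped Classical in
/-- The tags in `ρ` sample the letter `a₁` at position `k₁` of the value of `x₁` and the letter `a₂`
at the later position `k₂` of the value of `x₂`. -/
structure Samples (ρ : List (((Σ x, Q x) × Fin 3) × Finset (Tag A X) × ((Σ x, Q x) × Fin 3)))
    (x₁ : X) (a₁ : A) (k₁ : ℕ) (x₂ : X) (a₂ : A) (k₂ : ℕ) : Prop where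
  mis₁ : ∀ a x, occ (fun δ => Tag.mis₁ a x ∈ δ.2.1) ρ = if a = a₁ ∧ x = x₁ then 1 else 0
  mis₂ : ∀ a x, occ (fun δ => Tag.mis₂ a x ∈ δ.2.1) ρ = if a = a₂ ∧ x = x₂ then 1 else 0
  pos₁ : occ (fun δ => Tag.pos₁ x₁ ∈ δ.2.1) ρ = k₁
  pos₂ : occ (fun δ => Tag.pos₁ x₂ ∈ δ.2.1) ρ + occ (fun δ => Tag.pos₂ x₂ ∈ δ.2.1) ρ = k₂

theorem describes_lift (σ : List (Step A Q)) :
    Describes (σ.map (lift 0)) fun x => piece x σ :=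
  ⟨fun x => occ_len_lift 0 x σ, fun x t => occ_isCopyOf_lift 0 x t σ⟩

variable (σ₁ : List (Step A Q)) (x₁ : X) (t₁ : Q x₁ × A × Q x₁)
  (σ₂ : List (Step A Q)) (x₂ : X) (t₂ : Q x₂ × A × Q x₂) (σ₃ : List (Step A Q))

open scoped Classical in
theorem describes_markedRun : Describes (markedRun σ₁ x₁ t₁ σ₂ x₂ t₂ σ₃)
    fun x => piece x (unmarkedPath σ₁ x₁ t₁ σ₂ x₂ t₂ σ₃) := by
  constructor
  · intro x
    simp only [markedRun, unmarkedPath, occ_append, occ_cons, piece_append, List.length_append,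
      length_piece_cons, occ_len_lift]
    simp [mark₁, mark₂]
  · intro x t
    simp only [markedRun, unmarkedPath, occ_append, occ_cons, occ_isCopyOf_lift, occ_piece]
    -- The mismatch tags do not affect `IsCopyOf`: a marked transition is a copy of exactly its own
    -- letter step.
    have h₁ : IsCopyOf x t (mark₁ x₁ t₁.1 t₁.2.1 t₁.2.2) ↔
        letter x₁ t₁.1 t₁.2.1 t₁.2.2 = letter x t.1 t.2.1 t.2.2 := by
      by_cases h : x₁ = x
      · subst h
        simp [mark₁, IsCopyOf]
        tauto
      · simp [mark₁, IsCopyOf, h]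
    have h₂ : IsCopyOf x t (mark₂ x₂ t₂.1 t₂.2.1 t₂.2.2) ↔
        letter x₂ t₂.1 t₂.2.1 t₂.2.2 = letter x t.1 t.2.1 t.2.2 := by
      by_cases h : x₂ = x
      · subst h
        simp [mark₂, IsCopyOf]
        tauto
      · simp [mark₂, IsCopyOf, h]
    simp only [h₁, h₂]

open scoped Classical in
theorem occ_pos₁_markedRun (x : X) :
    occ (fun δ => Tag.pos₁ x ∈ δ.2.1) (markedRun σ₁ x₁ t₁ σ₂ x₂ t₂ σ₃) = (piece x σ₁).length := by
  have h (i : Fin 3) (σ : List (Step A Q)) := occ_pos_lift i 0 x σ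
  simp only [show posTag 0 x = (Tag.pos₁ x : Tag A X) from rfl] at h
  simp only [markedRun, occ_append, occ_cons, h]
  simp [mark₁, mark₂]

-- The extra summand comes from `mark₁`, which already carries the tag `pos₂`. In the case `x₁ = x₂`
-- it makes the `pos₁` and `pos₂` counts add up to the position of the second sampled letter.
open scoped Classical in
theorem occ_pos₂_markedRun (x : X) :
    occ (fun δ => Tag.pos₂ x ∈ δ.2.1) (markedRun σ₁ x₁ t₁ σ₂ x₂ t₂ σ₃) =
      (if x = x₁ then 1 else 0) + (piece x σ₂).length := by
  have h (i : Fin 3) (σ : List (Step A Q)) := occ_pos_lift i 1 x σ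
  simp only [show posTag 1 x = (Tag.pos₂ x : Tag A X) from rfl] at h
  simp only [markedRun, occ_append, occ_cons, h]
  simp [mark₁, mark₂]

open scoped Classical in
theorem samples_markedRun : Samples (markedRun σ₁ x₁ t₁ σ₂ x₂ t₂ σ₃)
    x₁ t₁.2.1 (piece x₁ σ₁).length x₂ t₂.2.1
    (piece x₂ (σ₁ ++ letter x₁ t₁.1 t₁.2.1 t₁.2.2 :: σ₂)).length where
  mis₁ a x := by
    simp only [markedRun, occ_append, occ_cons, occ_mis_lift _ (.mis₁ a x) _ ⟨a, x, .inl rfl⟩]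
    simp [mark₁, mark₂]
  mis₂ a x := by
    simp only [markedRun, occ_append, occ_cons, occ_mis_lift _ (.mis₂ a x) _ ⟨a, x, .inr rfl⟩]
    simp [mark₁, mark₂]
  pos₁ := occ_pos₁_markedRun ..
  pos₂ := by
    rw [occ_pos₁_markedRun, occ_pos₂_markedRun, piece_append, List.length_append,
      length_piece_cons]

variable {σ₁ x₁ t₁ σ₂ x₂ t₂ σ₃}

theorem piece_unmarkedPath_fst :
    (piece x₁ (unmarkedPath σ₁ x₁ t₁ σ₂ x₂ t₂ σ₃))[(piece x₁ σ₁).length]? = some t₁ := by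
  rw [unmarkedPath, piece_append, piece_cons_self]
  simp

theorem piece_unmarkedPath_snd :
    (piece x₂ (unmarkedPath σ₁ x₁ t₁ σ₂ x₂ t₂ σ₃))[(piece x₂
      (σ₁ ++ letter x₁ t₁.1 t₁.2.1 t₁.2.2 :: σ₂)).length]? = some t₂ := by
  rw [unmarkedPath, ← List.cons_append, ← List.append_assoc, piece_append, piece_cons_self]
  simp

end Runs

/-! ### Accepting runs of the three copies: decomposition and construction -/

section Decompose

variable {A X : Type*} [Fintype A] [Fintype X] [LinearOrder X] {Q : X → Type*}
  [∀ x, Fintype (Q x)] {aut : ∀ x, NFA A (Q x)}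
  {ρ : List (((Σ x, Q x) × Fin 3) × Finset (Tag A X) × ((Σ x, Q x) × Fin 3))}
  {r : (Σ x, Q x) × Fin 3} {p : Σ x, Q x}

/-- Both marked transitions start in earlier copies, so the last copy is never left. -/
theorem exists_eq_map_lift_two (hρ : ∀ δ ∈ ρ, δ ∈ (threeCopies (concatAut aut)).trans)
    (h : IsPath (fun δ => δ.1) (fun δ => δ.2.2) (p, (2 : Fin 3)) ρ r) :
    ∃ σ : List (Step A Q), ρ = σ.map (lift 2) ∧ (∀ s ∈ σ, s.Valid aut) ∧
      IsPath Step.src Step.tgt p σ r.1 ∧ r.2 = 2 := by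
  induction ρ generalizing p with
  | nil => obtain rfl : _ = r := h; exact ⟨[], rfl, by simp, rfl, rfl⟩
  | cons δ ρ ih =>
    obtain ⟨hδ, hρ'⟩ := List.forall_mem_cons.1 hρ
    obtain ⟨h₁, h₂⟩ := h
    rcases mem_threeCopies_trans.1 hδ with ⟨s, hs, i, rfl⟩ | ⟨x, q, a, r', hs, rfl | rfl⟩
    · simp only [lift_fst, Prod.mk.injEq] at h₁
      simp only [lift_snd_snd] at h₂
      obtain ⟨rfl, rfl⟩ := h₁
      obtain ⟨σ, rfl, h₃, h₄, h₅⟩ := ih hρ' h₂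
      exact ⟨s :: σ, rfl, List.forall_mem_cons.2 ⟨hs, h₃⟩, ⟨rfl, h₄⟩, h₅⟩
    · simp [mark₁] at h₁
    · simp [mark₂] at h₁

theorem exists_eq_append_of_path_one (hρ : ∀ δ ∈ ρ, δ ∈ (threeCopies (concatAut aut)).trans)
    (h : IsPath (fun δ => δ.1) (fun δ => δ.2.2) (p, (1 : Fin 3)) ρ r) (hr : r.2 ≠ 1) :
    ∃ (σ₂ : List (Step A Q)) (x₂ : X) (t₂ : Q x₂ × A × Q x₂) (σ₃ : List (Step A Q)),
      ρ = σ₂.map (lift 1) ++ mark₂ x₂ t₂.1 t₂.2.1 t₂.2.2 :: σ₃.map (lift 2) ∧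
      (∀ s ∈ σ₂ ++ letter x₂ t₂.1 t₂.2.1 t₂.2.2 :: σ₃, s.Valid aut) ∧
      IsPath Step.src Step.tgt p (σ₂ ++ letter x₂ t₂.1 t₂.2.1 t₂.2.2 :: σ₃) r.1 := by
  induction ρ generalizing p with
  | nil => obtain rfl : _ = r := h; exact (hr rfl).elim
  | cons δ ρ ih =>
    obtain ⟨hδ, hρ'⟩ := List.forall_mem_cons.1 hρ
    obtain ⟨h₁, h₂⟩ := h
    rcases mem_threeCopies_trans.1 hδ with ⟨s, hs, i, rfl⟩ | ⟨x, q, a, r', hs, rfl | rfl⟩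
    · simp only [lift_fst, Prod.mk.injEq] at h₁
      simp only [lift_snd_snd] at h₂
      obtain ⟨rfl, rfl⟩ := h₁
      obtain ⟨σ₂, x₂, t₂, σ₃, rfl, h₃, h₄⟩ := ih hρ' h₂
      exact ⟨s :: σ₂, x₂, t₂, σ₃, rfl, List.forall_mem_cons.2 ⟨hs, h₃⟩, rfl, h₄⟩
    · simp [mark₁] at h₁
    · simp only [mark₂, Prod.mk.injEq, and_true] at h₁
      obtain ⟨σ₃, rfl, h₃, h₄, -⟩ := exists_eq_map_lift_two hρ' h₂
      exact ⟨[], x, (q, a, r'), σ₃, rfl, List.forall_mem_cons.2 ⟨hs, h₃⟩, h₁, h₄⟩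

/-- The copies are passed in the order 0, 1, 2 and only through marks. Ending outside copy 1 leaves
no mark or both. -/
theorem exists_eq_of_path_zero (hρ : ∀ δ ∈ ρ, δ ∈ (threeCopies (concatAut aut)).trans)
    (h : IsPath (fun δ => δ.1) (fun δ => δ.2.2) (p, (0 : Fin 3)) ρ r) (hr : r.2 ≠ 1) :
    (∃ σ : List (Step A Q), ρ = σ.map (lift 0) ∧ (∀ s ∈ σ, s.Valid aut) ∧
      IsPath Step.src Step.tgt p σ r.1) ∨
    ∃ (σ₁ : List (Step A Q)) (x₁ : X) (t₁ : Q x₁ × A × Q x₁) (σ₂ : List (Step A Q)) (x₂ : X)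
      (t₂ : Q x₂ × A × Q x₂) (σ₃ : List (Step A Q)),
      ρ = markedRun σ₁ x₁ t₁ σ₂ x₂ t₂ σ₃ ∧
      (∀ s ∈ unmarkedPath σ₁ x₁ t₁ σ₂ x₂ t₂ σ₃, s.Valid aut) ∧
      IsPath Step.src Step.tgt p (unmarkedPath σ₁ x₁ t₁ σ₂ x₂ t₂ σ₃) r.1 := by
  induction ρ generalizing p with
  | nil => obtain rfl : _ = r := h; exact .inl ⟨[], rfl, by simp, rfl⟩
  | cons δ ρ ih =>
    obtain ⟨hδ, hρ'⟩ := List.forall_mem_cons.1 hρ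
    obtain ⟨h₁, h₂⟩ := h
    rcases mem_threeCopies_trans.1 hδ with ⟨s, hs, i, rfl⟩ | ⟨x, q, a, r', hs, rfl | rfl⟩
    · simp only [lift_fst, Prod.mk.injEq] at h₁
      simp only [lift_snd_snd] at h₂
      obtain ⟨rfl, rfl⟩ := h₁
      rcases ih hρ' h₂ with ⟨σ, rfl, h₃, h₄⟩ | ⟨σ₁, x₁, t₁, σ₂, x₂, t₂, σ₃, rfl, h₃, h₄⟩
      · exact .inl ⟨s :: σ, rfl, List.forall_mem_cons.2 ⟨hs, h₃⟩, rfl, h₄⟩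
      · exact .inr ⟨s :: σ₁, x₁, t₁, σ₂, x₂, t₂, σ₃, rfl, List.forall_mem_cons.2 ⟨hs, h₃⟩, rfl, h₄⟩
    · simp only [mark₁, Prod.mk.injEq, and_true] at h₁
      obtain ⟨σ₂, x₂, t₂, σ₃, rfl, h₃, h₄⟩ := exists_eq_append_of_path_one hρ' h₂ hr
      exact .inr ⟨[], x, (q, a, r'), σ₂, x₂, t₂, σ₃, rfl, List.forall_mem_cons.2 ⟨hs, h₃⟩, h₁, h₄⟩
    · simp [mark₂] at h₁

omit [Fintype A] in
theorem mem_epsConcat_init {B : ∀ x, TagAutomaton (Tag A X) (Q x)} {p : Σ x, Q x} :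
    p ∈ (epsConcat B).init ↔ IsBot p.1 ∧ p.2 ∈ (B p.1).init := by
  simp [epsConcat]

omit [Fintype A] in
theorem mem_epsConcat_final {B : ∀ x, TagAutomaton (Tag A X) (Q x)} {p : Σ x, Q x} :
    p ∈ (epsConcat B).final ↔ IsTop p.1 ∧ p.2 ∈ (B p.1).final := by
  simp [epsConcat]

theorem mem_threeCopies_init {p : (Σ x, Q x) × Fin 3} :
    p ∈ (threeCopies (concatAut aut)).init ↔
      (IsBot p.1.1 ∧ p.1.2 ∈ (aut p.1.1).start) ∧ p.2 = 0 := by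
  simp only [threeCopies, Finset.mem_product, mem_epsConcat_init, Finset.mem_singleton]
  simp [lenTag]

theorem mem_threeCopies_final {p : (Σ x, Q x) × Fin 3} :
    p ∈ (threeCopies (concatAut aut)).final ↔
      (IsTop p.1.1 ∧ p.1.2 ∈ (aut p.1.1).accept) ∧ (p.2 = 0 ∨ p.2 = 2) := by
  simp only [threeCopies, Finset.mem_product, mem_epsConcat_final, Finset.mem_insert,
    Finset.mem_singleton]
  simp [lenTag]

/-- An accepting run of `threeCopies` describes accepting paths of all the automata, and the
positions that it samples if it samples any. -/
theorem exists_describes {p r : (Σ x, Q x) × Fin 3}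
    (h : (threeCopies (concatAut aut)).IsAcceptingRun p ρ r) :
    ∃ R : ∀ x, List (Q x × A × Q x), (∀ x, (aut x).IsAcceptingPath (R x)) ∧ Describes ρ R ∧
      ((∀ a x, occ (fun δ => Tag.mis₁ a x ∈ δ.2.1) ρ = 0) ∨
        ∃ x₁ t₁ k₁ x₂ t₂ k₂, Samples ρ x₁ t₁.2.1 k₁ x₂ t₂.2.1 k₂ ∧
          (R x₁)[k₁]? = some t₁ ∧ (R x₂)[k₂]? = some t₂ ∧
          (x₁ < x₂ → occ (fun δ => Tag.pos₁ x₂ ∈ δ.2.1) ρ = 0)) := by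
  obtain ⟨hp, hr, hρ, hpath⟩ := h
  obtain ⟨p, i⟩ := p
  obtain ⟨hp, rfl : i = 0⟩ := mem_threeCopies_init.1 hp
  obtain ⟨hr, hri⟩ := mem_threeCopies_final.1 hr
  rcases exists_eq_of_path_zero hρ hpath (by rcases hri with h | h <;> simp [h]) with
    ⟨σ, rfl, hσ, hσp⟩ | ⟨σ₁, x₁, t₁, σ₂, x₂, t₂, σ₃, rfl, hσ, hσp⟩
  · refine ⟨_, isAcceptingPath_piece hσ hσp hp hr, describes_lift σ, .inl fun a x => ?_⟩
    exact occ_mis_lift 0 _ σ ⟨a, x, .inl rfl⟩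
  · refine ⟨_, isAcceptingPath_piece hσ hσp hp hr, describes_markedRun .., .inr ⟨x₁, t₁, _, x₂, t₂,
      _, samples_markedRun .., piece_unmarkedPath_fst, piece_unmarkedPath_snd, fun hlt => ?_⟩⟩
    -- Tags `pos₁` occur only before the first mark, where the path has not gone beyond the
    -- automaton of `x₁`.
    obtain ⟨q, hq, hq', -⟩ := isPath_append.1 hσp
    have hσ₁ : ∀ s ∈ σ₁, s.Valid aut := fun s hs => hσ s (List.mem_append_left _ hs)
    rw [occ_pos₁_markedRun, piece_eq_nil_of_lt hσ₁ hq (.inr (hq' ▸ hlt)), List.length_nil]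

theorem mem_threeCopies_trans_lift {s : Step A Q} (hs : s.Valid aut) (i : Fin 3) :
    s.lift i ∈ (threeCopies (concatAut aut)).trans :=
  mem_threeCopies_trans.2 (.inl ⟨s, hs, i, rfl⟩)

/-- Accepting paths of all the automata are described by a run of `threeCopies`. -/
theorem exists_run_describes [Nonempty X] {R : ∀ x, List (Q x × A × Q x)}
    (hR : ∀ x, (aut x).IsAcceptingPath (R x)) :
    ∃ p ρ r, (threeCopies (concatAut aut)).IsAcceptingRun p ρ r ∧ Describes ρ R := by
  obtain ⟨p, σ, r, hσ, hpath, hp, hr, hpiece⟩ := exists_path_of_isAcceptingPath hR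
  obtain rfl : (fun x => piece x σ) = R := funext hpiece
  refine ⟨(p, 0), σ.map (lift 0), (r, 0), ⟨mem_threeCopies_init.2 ⟨hp, rfl⟩,
    mem_threeCopies_final.2 ⟨hr, .inl rfl⟩, ?_, isPath_map_lift 0 hpath⟩, describes_lift σ⟩
  intro δ hδ
  obtain ⟨s, hs, rfl⟩ := List.mem_map.1 hδ
  exact mem_threeCopies_trans_lift (hσ s hs) 0

/-- Any two distinct positions in accepting paths are sampled by a run of `threeCopies`. -/
theorem exists_run_samples {R : ∀ x, List (Q x × A × Q x)}
    (hR : ∀ x, (aut x).IsAcceptingPath (R x)) {x₁ x₂ : X} {k₁ k₂ : ℕ} {t₁ t₂}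
    (h₁ : (R x₁)[k₁]? = some t₁) (h₂ : (R x₂)[k₂]? = some t₂)
    (hlt : x₁ < x₂ ∨ x₁ = x₂ ∧ k₁ < k₂) :
    ∃ p ρ r, (threeCopies (concatAut aut)).IsAcceptingRun p ρ r ∧ Describes ρ R ∧
      Samples ρ x₁ t₁.2.1 k₁ x₂ t₂.2.1 k₂ ∧
      (x₁ < x₂ → occ (fun δ => Tag.pos₁ x₂ ∈ δ.2.1) ρ = 0) := by
  have : Nonempty X := ⟨x₁⟩
  obtain ⟨p, σ, r, hσ, hpath, hp, hr, hpiece⟩ := exists_path_of_isAcceptingPath hR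
  obtain rfl : (fun x => piece x σ) = R := funext hpiece
  obtain ⟨σ₁, τ, rfl, rfl⟩ := exists_split_of_getElem?_piece h₁
  obtain ⟨q₁, hq₁, hpath'⟩ := isPath_append.1 hpath
  have hσ₁ : ∀ s ∈ σ₁, s.Valid aut := fun s hs => hσ s (List.mem_append_left _ hs)
  have hnil (h : x₁ < x₂) : piece x₂ σ₁ = [] :=
    piece_eq_nil_of_lt hσ₁ hq₁ (.inr (hpath'.1 ▸ h))
  obtain ⟨σ₂, σ₃, rfl, hk₂⟩ : ∃ σ₂ σ₃, τ = σ₂ ++ letter x₂ t₂.1 t₂.2.1 t₂.2.2 :: σ₃ ∧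
      (piece x₂ (σ₁ ++ letter x₁ t₁.1 t₁.2.1 t₁.2.2 :: σ₂)).length = k₂ := by
    -- By `hlt` the second position comes strictly after the first marked step, so it can be located
    -- in the remaining path `τ`.
    have hle : (piece x₂ (σ₁ ++ [letter x₁ t₁.1 t₁.2.1 t₁.2.2])).length ≤ k₂ := by
      rcases hlt with hlt | ⟨rfl, hlt⟩
      · rw [piece_append, hnil hlt, piece_cons_ne hlt.ne]
        simp
      · rw [piece_append, piece_cons_self]
        simpa using hlt
    change (piece x₂ _)[k₂]? = _ at h₂
    rw [← List.singleton_append, ← List.append_assoc, piece_append,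
      List.getElem?_append_right hle] at h₂
    obtain ⟨σ₂, σ₃, rfl, h⟩ := exists_split_of_getElem?_piece h₂
    refine ⟨σ₂, σ₃, rfl, ?_⟩
    rw [← List.singleton_append, ← List.append_assoc, piece_append, List.length_append, h]
    omega
  obtain ⟨rfl, q₂, hq₂, rfl, hq₃⟩ := hpath'.imp_right isPath_append.1
  change ∀ s ∈ unmarkedPath σ₁ x₁ t₁ σ₂ x₂ t₂ σ₃, s.Valid aut at hσ
  have hmem : ∀ s ∈ σ₂ ++ letter x₂ t₂.1 t₂.2.1 t₂.2.2 :: σ₃, s.Valid aut := fun s hs =>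
    hσ s (List.mem_append_right _ (List.mem_cons_of_mem _ hs))
  refine ⟨(p, 0), markedRun σ₁ x₁ t₁ σ₂ x₂ t₂ σ₃, (r, 2), ⟨mem_threeCopies_init.2 ⟨hp, rfl⟩,
    mem_threeCopies_final.2 ⟨hr, .inr rfl⟩, ?_, ?_⟩, describes_markedRun .., ?_, ?_⟩
  · simp only [markedRun, List.forall_mem_append, List.forall_mem_cons, List.forall_mem_map]
    refine ⟨fun s hs => mem_threeCopies_trans_lift (hσ₁ s hs) 0,
      mem_threeCopies_trans.2 (.inr ⟨x₁, _, _, _, ?_, .inl rfl⟩), fun s hs =>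
      mem_threeCopies_trans_lift (hmem s (List.mem_append_left _ hs)) 1,
      mem_threeCopies_trans.2 (.inr ⟨x₂, _, _, _, ?_, .inr rfl⟩), fun s hs =>
      mem_threeCopies_trans_lift
        (hmem s (List.mem_append_right _ (List.mem_cons_of_mem _ hs))) 2⟩
    · exact hσ (letter x₁ t₁.1 t₁.2.1 t₁.2.2) (by simp [unmarkedPath])
    · exact hσ (letter x₂ t₂.1 t₂.2.1 t₂.2.2) (by simp [unmarkedPath])
  · exact isPath_append.2 ⟨_, isPath_map_lift 0 hq₁, rfl, isPath_append.2
      ⟨_, isPath_map_lift 1 hq₂, rfl, isPath_map_lift 2 hq₃⟩⟩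
  · rw [← hk₂]
    exact samples_markedRun ..
  · intro hlt
    rw [occ_pos₁_markedRun, hnil hlt, List.length_nil]

end Decompose

end NotContains

/-! ### Mismatches between concatenations of words -/

/-- A factor is an offset at which all letters agree, and only offsets with `κ + U.length ≤
V.length` are candidates. These are the offsets not excluded by the last two disjuncts of the
formula. -/
theorem not_isInfix_iff {A : Type*} {U V : List A} :
    ¬ U <:+: V ↔ ∀ κ : ℕ, κ + U.length ≤ V.length →
      ∃ (p : ℕ) (a b : A), U[p]? = some a ∧ V[κ + p]? = some b ∧ a ≠ b := by
  constructor
  · intro h κ hκ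
    by_contra! hcon
    refine h ⟨V.take κ, V.drop (κ + U.length), ?_⟩
    have : U = (V.drop κ).take U.length := by
      refine List.ext_getElem (by simp; omega) fun p hp₁ hp₂ => ?_
      rw [List.getElem_take, List.getElem_drop]
      exact hcon p _ _ (List.getElem?_eq_getElem hp₁) (List.getElem?_eq_getElem (by omega))
    rw [← List.drop_drop, List.append_assoc]
    nth_rewrite 1 [this]
    rw [List.take_append_drop, List.take_append_drop]
  · rintro h ⟨s, t, rfl⟩
    obtain ⟨p, a, b, h₁, h₂, hab⟩ := h s.length (by simp)
    obtain ⟨hp, rfl⟩ := List.getElem?_eq_some_iff.1 h₁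
    rw [List.append_assoc, List.getElem?_append_right (by omega), Nat.add_sub_cancel_left,
      List.getElem?_append_left hp, h₁] at h₂
    exact hab (Option.some.inj h₂)

section TermValue

variable {A X : Type*} {σ : X → List A}

theorem termValue_append (w w' : List X) :
    termValue σ (w ++ w') = termValue σ w ++ termValue σ w' := by
  simp [termValue]

theorem length_termValue (w : List X) :
    (termValue σ w).length = (w.map fun x => (σ x).length).sum := by
  simp [termValue, List.length_flatten, Function.comp_def]

/-- Together with `exists_of_getElem?_termValue` this matches positions in a concatenation with
pairs of an occurrence of a variable and a position in its word. -/
theorem getElem?_termValue {w : List X} (i : Fin w.length) {o : ℕ} {a : A}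
    (h : (σ (w.get i))[o]? = some a) :
    (termValue σ w)[(termValue σ (w.take i)).length + o]? = some a := by
  obtain ⟨ho, -⟩ := List.getElem?_eq_some_iff.1 h
  have hw : termValue σ w =
      termValue σ (w.take i) ++ (σ (w.get i) ++ termValue σ (w.drop (i + 1))) := by
    conv_lhs => rw [← List.take_append_drop i w, List.drop_eq_getElem_cons i.2]
    rw [termValue_append]
    rfl
  rw [hw, List.getElem?_append_right (by omega), Nat.add_sub_cancel_left,
    List.getElem?_append_left ho, h]

theorem exists_of_getElem?_termValue {w : List X} {p : ℕ} {a : A}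
    (h : (termValue σ w)[p]? = some a) :
    ∃ (i : Fin w.length) (o : ℕ), (σ (w.get i))[o]? = some a ∧
      p = (termValue σ (w.take i)).length + o := by
  induction w generalizing p with
  | nil => simp [termValue] at h
  | cons x w ih =>
    rw [show termValue σ (x :: w) = σ x ++ termValue σ w from rfl] at h
    by_cases hp : p < (σ x).length
    · rw [List.getElem?_append_left hp] at h
      exact ⟨⟨0, by simp⟩, p, h, by simp [termValue]⟩
    · rw [List.getElem?_append_right (by omega)] at h
      obtain ⟨i, o, h₁, h₂⟩ := ih h
      refine ⟨i.succ, o, h₁, ?_⟩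
      rw [show (x :: w).take i.succ = x :: w.take i from rfl,
        show termValue σ (x :: w.take i) = σ x ++ termValue σ (w.take i) from rfl,
        List.length_append]
      omega

theorem termValue_congr {τ : X → List A} {w : List X} (h : ∀ x ∈ w, σ x = τ x) :
    termValue σ w = termValue τ w := by
  rw [termValue, termValue, List.map_congr_left h]

end TermValue

namespace NFA

variable {A Q : Type*}

theorem parikh_eq_occ (ρ : List (Q × A × Q)) (t : Q × A × Q) :
    parikh ρ t = occ (fun s => s = t) ρ := by
  classical
  rw [occ_eq_countP, parikh]

/-- Triples that are not transitions of `M` occur in neither path. It therefore suffices to compare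
the counts that the formula compares. -/
theorem IsFlat.eq_of_parikh_eq {M : NFA A Q} {ρ ρ' : List (Q × A × Q)} (hM : M.IsFlat)
    (hρ : M.IsAcceptingPath ρ) (hρ' : M.IsAcceptingPath ρ')
    (h : ∀ q a r, r ∈ M.step q a → parikh ρ (q, a, r) = parikh ρ' (q, a, r)) : ρ = ρ' := by
  refine hM _ _ hρ.isRun hρ'.isRun (funext fun ⟨q, a, r⟩ => ?_)
  by_cases hr : r ∈ M.step q a
  · exact h q a r hr
  · have hz {ρ : List (Q × A × Q)} (hρ : M.IsAcceptingPath ρ) : parikh ρ (q, a, r) = 0 := by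
      rw [parikh_eq_occ, occ_eq_zero]
      rintro t ht rfl
      exact hr (hρ.isRun.1 _ ht)
    rw [hz hρ, hz hρ']

end NFA

/-! ### Meaning of the mismatch, symbol and equal-word formulae -/

namespace NotContains

open LIATerm LIAFormula Step TagAutomaton

section Semantics

variable {A X V : Type*} {Q : X → Type*}

/-- The words read by paths of the automata. -/
def wordsOf (R : ∀ x, List (Q x × A × Q x)) (x : X) : List A :=
  (R x).map fun t => t.2.1

/-- The values `f` of the Parikh variables are the numbers of occurrences of the tags in `ρ`. -/
def CountsTags (f : ParikhVar (Tag A X) ((Σ x, Q x) × Fin 3) → ℤ)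
    (ρ : List (((Σ x, Q x) × Fin 3) × Finset (Tag A X) × ((Σ x, Q x) × Fin 3))) : Prop :=
  ∀ t, f (.tag t) = occ (fun δ => t ∈ δ.2.1) ρ

variable {ν : ParikhVar (Tag A X) ((Σ x, Q x) × Fin 3) → V} {α : V → ℤ}
  {ρ : List (((Σ x, Q x) × Fin 3) × Finset (Tag A X) × ((Σ x, Q x) × Fin 3))}
  {R : ∀ x, List (Q x × A × Q x)}

theorem eval_tagCount (hc : CountsTags (α ∘ ν) ρ) (t : Tag A X) :
    (tagCount ν t).eval α = occ (fun δ => t ∈ δ.2.1) ρ := hc t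

theorem eval_lenSum (hc : CountsTags (α ∘ ν) ρ) (hR : Describes ρ R) (w : List X) :
    (lenSum ν w).eval α = (termValue (wordsOf R) w).length := by
  rw [lenSum, eval_sum, List.map_map, length_termValue]
  induction w with
  | nil => rfl
  | cons x w ih =>
    rw [List.map_cons, List.map_cons, List.sum_cons, List.sum_cons, ih, Nat.cast_add]
    congr 1
    simp only [Function.comp_apply]
    rw [eval_tagCount hc, hR.len, wordsOf, List.length_map]

variable {x₁ x₂ : X} {a₁ a₂ : A} {k₁ k₂ : ℕ}

/-- The sum for a letter counts how many of the two samples are that letter, and it reaches 2 only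
when both are. -/
theorem holds_symFormula_iff [Fintype A] [Fintype X] (hc : CountsTags (α ∘ ν) ρ)
    (hs : Samples ρ x₁ a₁ k₁ x₂ a₂ k₂) : (symFormula ν).holds α ↔ a₁ ≠ a₂ := by
  classical
  have hsum (f : X → LIATerm V) :
      (LIATerm.sum ((Finset.univ : Finset X).toList.map f)).eval α = ∑ x, (f x).eval α := by
    rw [eval_sum, List.map_map, Finset.sum_map_toList]
    rfl
  have key (b : A) (y : X) (a : A) :
      ∑ x, (((if a = b ∧ x = y then 1 else 0 : ℕ) : ℤ)) = if a = b then 1 else 0 := by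
    by_cases h : a = b <;> simp [h]
  simp only [symFormula, holds_conj, List.mem_map, Finset.mem_toList, Finset.mem_univ, true_and,
    forall_exists_index, forall_apply_eq_imp_iff, holds_lt, hsum, eval, eval_tagCount hc,
    hs.mis₁, hs.mis₂, Finset.sum_add_distrib, key]
  constructor
  · rintro h rfl
    simpa using h a₁
  · intro h a
    by_cases h₁ : a = a₁
    · rw [if_pos h₁, if_neg (h₁ ▸ h)]; norm_num
    · rw [if_neg h₁]; split_ifs <;> norm_num

theorem holds_sampledFormula [Fintype A] (hc : CountsTags (α ∘ ν) ρ) {x y : X} :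
    (sampledFormula ν x y).holds α ↔ (∃ a, 0 < occ (fun δ => Tag.mis₁ a x ∈ δ.2.1) ρ) ∧
      ∃ a, 0 < occ (fun δ => Tag.mis₂ a y ∈ δ.2.1) ρ := by
  have hsum (f : A → Tag A X) :
      0 < (LIATerm.sum ((Finset.univ : Finset A).toList.map fun a => tagCount ν (f a))).eval α ↔
        ∃ a, 0 < occ (fun δ => f a ∈ δ.2.1) ρ := by
    rw [eval_sum, List.map_map, Finset.sum_map_toList]
    simp only [Function.comp_apply, eval_tagCount hc]
    rw [← Nat.cast_sum, Nat.cast_pos, Finset.sum_pos_iff]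
    simp
  simp only [sampledFormula, holds, holds_lt, eval, hsum]

theorem holds_sampledFormula_iff [Fintype A] (hc : CountsTags (α ∘ ν) ρ)
    (hs : Samples ρ x₁ a₁ k₁ x₂ a₂ k₂) {x y : X} :
    (sampledFormula ν x y).holds α ↔ x = x₁ ∧ y = x₂ := by
  classical
  rw [holds_sampledFormula hc]
  simp only [hs.mis₁, hs.mis₂]
  refine and_congr ⟨?_, fun h => ⟨a₁, by simp [h]⟩⟩ ⟨?_, fun h => ⟨a₂, by simp [h]⟩⟩
  · rintro ⟨a, ha⟩
    by_contra hx
    simp [hx] at ha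
  · rintro ⟨a, ha⟩
    by_contra hx
    simp [hx] at ha

variable [LinearOrder X] {κ : V} {u v : List X}

theorem holds_misFormula [Fintype A] : (misFormula κ ν u v).holds α ↔
    ∃ (i : Fin u.length) (j : Fin v.length), (posFormula κ ν u v i j).holds α ∧
      (if u.get i ≤ v.get j then (sampledFormula ν (u.get i) (v.get j)).holds α
        else (sampledFormula ν (v.get j) (u.get i)).holds α) := by
  simp only [misFormula, holds_disj, List.mem_flatMap, List.mem_map, List.mem_finRange, true_and]
  constructor
  · rintro ⟨_, ⟨i, j, rfl⟩, h⟩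
    refine ⟨i, j, h.1, ?_⟩
    have := h.2
    split_ifs at this ⊢ <;> exact this
  · rintro ⟨i, j, h₁, h₂⟩
    refine ⟨_, ⟨i, j, rfl⟩, h₁, ?_⟩
    split_ifs at h₂ ⊢ <;> exact h₂

/-- A sampled pair of positions satisfies the mismatch formula if and only if the positions are
aligned in some occurrences in `u` and `v`. -/
theorem holds_misFormula_iff [Fintype A] (hc : CountsTags (α ∘ ν) ρ) (hR : Describes ρ R)
    (hs : Samples ρ x₁ a₁ k₁ x₂ a₂ k₂)
    (h0 : x₁ < x₂ → occ (fun δ => Tag.pos₁ x₂ ∈ δ.2.1) ρ = 0) (hle : x₁ ≤ x₂) :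
    (misFormula κ ν u v).holds α ↔ ∃ (i : Fin u.length) (j : Fin v.length),
      (u.get i = x₁ ∧ v.get j = x₂ ∧
        α κ + ((termValue (wordsOf R) (u.take i)).length + k₁) =
          (termValue (wordsOf R) (v.take j)).length + k₂) ∨
      (u.get i = x₂ ∧ v.get j = x₁ ∧
        α κ + ((termValue (wordsOf R) (u.take i)).length + k₂) =
          (termValue (wordsOf R) (v.take j)).length + k₁) := by
  rw [holds_misFormula]
  refine exists_congr fun i => exists_congr fun j => ?_
  simp only [holds_sampledFormula_iff hc hs]
  have h₁ := hs.pos₁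
  have h₂ := hs.pos₂
  set x := u.get i with hx
  set y := v.get j with hy
  rcases lt_trichotomy x y with hxy | hxy | hxy
  -- For different variables the smaller one is sampled first. By `h0` the larger one has no `pos₁`
  -- tags, so its `pos₂` count alone is the second position.
  · simp only [posFormula, ← hx, ← hy, if_neg hxy.ne, if_pos hxy, if_pos hxy.le, holds, eval,
      eval_tagCount hc, eval_lenSum hc hR]
    constructor
    · rintro ⟨h, rfl, rfl⟩
      rw [h0 hxy, zero_add] at h₂
      rw [h₁, h₂] at h
      exact .inl ⟨rfl, rfl, by omega⟩
    · rintro (⟨rfl, rfl, h⟩ | ⟨rfl, rfl, h⟩)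
      · rw [h0 hxy, zero_add] at h₂
        rw [h₁, h₂]
        exact ⟨by omega, rfl, rfl⟩
      · exact (hxy.not_ge hle).elim
  -- When both samples lie in the word of one variable, either may belong to `u`. The two disjuncts
  -- of `posFormula` are these two choices.
  · simp only [posFormula, ← hx, ← hy, if_pos hxy, if_pos hxy.le, holds, eval,
      eval_tagCount hc, eval_lenSum hc hR]
    rw [← hxy]
    constructor
    · rintro ⟨h, rfl, rfl⟩
      rw [h₁] at h h₂
      rcases h with h | h
      · exact .inl ⟨rfl, rfl, by omega⟩
      · exact .inr ⟨rfl, rfl, by omega⟩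
    · rintro (⟨rfl, h', h⟩ | ⟨h', rfl, h⟩)
      · rw [← h', h₁] at h₂
        rw [h₁]
        exact ⟨.inl (by omega), rfl, h'⟩
      · rw [← h', h₁] at h₂
        rw [h₁]
        exact ⟨.inr (by omega), rfl, h'⟩
  · simp only [posFormula, ← hx, ← hy, if_neg hxy.ne', if_neg hxy.not_gt, if_neg hxy.not_ge, holds,
      eval, eval_tagCount hc, eval_lenSum hc hR]
    constructor
    · rintro ⟨h, rfl, rfl⟩
      rw [h0 hxy, zero_add] at h₂
      rw [h₁, h₂] at h
      exact .inr ⟨rfl, rfl, by omega⟩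
    · rintro (⟨rfl, rfl, h⟩ | ⟨rfl, rfl, h⟩)
      · exact (hxy.not_ge hle).elim
      · rw [h0 hxy, zero_add] at h₂
        rw [h₁, h₂]
        exact ⟨by omega, rfl, rfl⟩

end Semantics

section Automata

variable {A X V : Type*} [Fintype A] [Fintype X] [LinearOrder X] {Q : X → Type*}
  [∀ x, Fintype (Q x)] {aut : ∀ x, NFA A (Q x)}
  {ρ ρ' : List (((Σ x, Q x) × Fin 3) × Finset (Tag A X) × ((Σ x, Q x) × Fin 3))}
  {R R' : ∀ x, List (Q x × A × Q x)}
  {ν ν' : ParikhVar (Tag A X) ((Σ x, Q x) × Fin 3) → V} {α : V → ℤ}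

theorem countsTags_of_countsRun [Nonempty X] {f : ParikhVar (Tag A X) ((Σ x, Q x) × Fin 3) → ℤ}
    (h : (threeCopies (concatAut aut)).CountsRun f ρ) : CountsTags f ρ :=
  fun t => h.tag t (mem_threeCopies_tags t)

theorem holds_equalWordFormula_iff (hc : (threeCopies (concatAut aut)).CountsRun (α ∘ ν) ρ)
    (hρ : ∀ δ ∈ ρ, δ ∈ (threeCopies (concatAut aut)).trans) (hR : Describes ρ R)
    (hc' : (threeCopies (concatAut aut)).CountsRun (α ∘ ν') ρ')
    (hρ' : ∀ δ ∈ ρ', δ ∈ (threeCopies (concatAut aut)).trans) (hR' : Describes ρ' R') :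
    (equalWordFormula (concatAut aut) ν ν').holds α ↔
      ∀ x q a r, r ∈ (aut x).step q a →
        NFA.parikh (R x) (q, a, r) = NFA.parikh (R' x) (q, a, r) := by
  -- The predicate `copies` of the formula is definitionally `IsCopyOf` for the given transition.
  have key (x q a r) : (LIAFormula.eq
      ((threeCopies (concatAut aut)).transSum ν (IsCopyOf x (q, a, r)))
      ((threeCopies (concatAut aut)).transSum ν' (IsCopyOf x (q, a, r)))).holds α ↔
        NFA.parikh (R x) (q, a, r) = NFA.parikh (R' x) (q, a, r) := by
    rw [holds, hc.eval_transSum hρ, hc'.eval_transSum hρ', hR.copy, hR'.copy, Nat.cast_inj,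
      NFA.parikh_eq_occ, NFA.parikh_eq_occ]
  simp only [equalWordFormula, holds_conj, List.mem_flatMap, List.mem_map, Finset.mem_toList,
    Finset.mem_univ, true_and, mem_letterTrans]
  constructor
  · intro h x q a r hr
    exact (key x q a r).1 (h _ ⟨(a, x), _, ⟨q, r, hr, rfl⟩, rfl⟩)
  · rintro h _ ⟨⟨a, x⟩, _, ⟨q, r, hr, rfl⟩, rfl⟩
    exact (key x q a r).2 (h x q a r hr)

open scoped Classical in
theorem countsRun_congr {f g : ParikhVar (Tag A X) ((Σ x, Q x) × Fin 3) → ℤ}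
    (h : (threeCopies (concatAut aut)).CountsRun f ρ)
    (hfg : ∀ p ∈ (threeCopies (concatAut aut)).parikhVars, g p = f p) :
    (threeCopies (concatAut aut)).CountsRun g ρ :=
  ⟨fun δ hδ => (hfg _ (by simp [parikhVars, hδ])).trans (h.trans δ hδ),
    fun t ht => (hfg _ (by
      simp only [parikhVars, Finset.mem_union, Finset.mem_image]
      exact .inl (.inl (.inl (.inr ⟨t, ht, rfl⟩))))).trans (h.tag t ht)⟩

variable {κ : V} {u v : List X}

/-- The matrix of the formula yields a mismatch for the offset `κ`. -/
theorem exists_mismatch_of_holds (hflat : ∀ x, x ∈ u ∨ x ∈ v → (aut x).IsFlat) [Nonempty X]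
    (hc : (threeCopies (concatAut aut)).CountsRun (α ∘ ν) ρ)
    (hρ : ∀ δ ∈ ρ, δ ∈ (threeCopies (concatAut aut)).trans) (hR : Describes ρ R)
    (hacc : ∀ x, (aut x).IsAcceptingPath (R x))
    (hpar : ((threeCopies (concatAut aut)).parikhTagFormula ν').holds α)
    (heq : (equalWordFormula (concatAut aut) ν ν').holds α) (hsym : (symFormula ν').holds α)
    (hmis : (misFormula κ ν' u v).holds α) :
    ∃ (p q : ℕ) (a b : A), (termValue (wordsOf R) u)[p]? = some a ∧
      (termValue (wordsOf R) v)[q]? = some b ∧ a ≠ b ∧ α κ + p = q := by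
  obtain ⟨p₀, ρ', r₀, hrun, hc'⟩ := exists_run_of_holds hpar
  obtain ⟨R', hacc', hR', hsam⟩ := exists_describes hrun
  have ht := countsTags_of_countsRun hc'
  have hpar := (holds_equalWordFormula_iff hc hρ hR hc' hrun.trans hR').1 heq
  -- Flatness makes the second run read the same words as the first for the variables of `u` and
  -- `v`; words of other variables do not matter.
  have hRR (x) (hx : x ∈ u ∨ x ∈ v) : wordsOf R x = wordsOf R' x := by
    rw [wordsOf, wordsOf, (hflat x hx).eq_of_parikh_eq (hacc x) (hacc' x) (hpar x)]
  rw [termValue_congr fun x hx => hRR x (.inl hx), termValue_congr fun x hx => hRR x (.inr hx)]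
  rcases hsam with h0 | ⟨x₁, t₁, k₁, x₂, t₂, k₂, hs, h₁, h₂, hz⟩
  -- A run without marks cannot satisfy the mismatch formula, which demands a first sample.
  · obtain ⟨i, j, -, h⟩ := holds_misFormula.1 hmis
    simp only [holds_sampledFormula ht, h0, lt_self_iff_false, exists_false, false_and,
      ite_self] at h
  · have hab := (holds_symFormula_iff ht hs).1 hsym
    have hle : x₁ ≤ x₂ := by
      obtain ⟨i, j, -, h⟩ := holds_misFormula.1 hmis
      simp only [holds_sampledFormula_iff ht hs] at h
      split_ifs at h with hij
      · exact h.1 ▸ h.2 ▸ hij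
      · exact h.1 ▸ h.2 ▸ (not_le.1 hij).le
    have hw₁ : (wordsOf R' x₁)[k₁]? = some t₁.2.1 := by simp [wordsOf, h₁]
    have hw₂ : (wordsOf R' x₂)[k₂]? = some t₂.2.1 := by simp [wordsOf, h₂]
    obtain ⟨i, j, ⟨rfl, rfl, h⟩ | ⟨rfl, rfl, h⟩⟩ :=
      (holds_misFormula_iff ht hR' hs hz hle).1 hmis
    · exact ⟨_, _, _, _, getElem?_termValue i hw₁, getElem?_termValue j hw₂, hab, by
        push_cast; exact h⟩
    · exact ⟨_, _, _, _, getElem?_termValue i hw₂, getElem?_termValue j hw₁, hab.symm, by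
        push_cast; exact h⟩

/-- A mismatch for the offset `k` yields Parikh variables that satisfy the matrix of the formula. -/
theorem exists_values_of_mismatch (hacc : ∀ x, (aut x).IsAcceptingPath (R x))
    (hR : Describes ρ R) {k p : ℕ} {a b : A} (hu : (termValue (wordsOf R) u)[p]? = some a)
    (hv : (termValue (wordsOf R) v)[k + p]? = some b) (hab : a ≠ b)
    (hρ : ∀ δ ∈ ρ, δ ∈ (threeCopies (concatAut aut)).trans) :
    ∃ f : ParikhVar (Tag A X) ((Σ x, Q x) × Fin 3) → ℤ,
      ∀ {V : Type _} (ν ν' : ParikhVar (Tag A X) ((Σ x, Q x) × Fin 3) → V) (κ : V) (α : V → ℤ),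
        (threeCopies (concatAut aut)).CountsRun (α ∘ ν) ρ → α κ = k →
        (∀ x ∈ (threeCopies (concatAut aut)).parikhVars, α (ν' x) = f x) →
        ((threeCopies (concatAut aut)).parikhTagFormula ν').holds α ∧
        (equalWordFormula (concatAut aut) ν ν').holds α ∧ (symFormula ν').holds α ∧
        (misFormula κ ν' u v).holds α := by
  obtain ⟨i, o, hi, rfl⟩ := exists_of_getElem?_termValue hu
  obtain ⟨j, o', hj, hk⟩ := exists_of_getElem?_termValue hv
  have : Nonempty X := ⟨u.get i⟩
  obtain ⟨t, ht, rfl⟩ : ∃ t, (R (u.get i))[o]? = some t ∧ t.2.1 = a := by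
    simpa [wordsOf, List.getElem?_map] using hi
  obtain ⟨t', ht', rfl⟩ : ∃ t, (R (v.get j))[o']? = some t ∧ t.2.1 = b := by
    simpa [wordsOf, List.getElem?_map] using hj
  -- The run meets the two letters in the order of variables and then of positions, so the one in
  -- `v` may have to be sampled first.
  obtain ⟨x₁, a₁, k₁, x₂, a₂, k₂, hne, hle, hpos, q, ρ', r, hrun, hR', hs, hz⟩ :
      ∃ x₁ a₁ k₁ x₂ a₂ k₂, a₁ ≠ a₂ ∧ x₁ ≤ x₂ ∧
        ((u.get i = x₁ ∧ v.get j = x₂ ∧ o = k₁ ∧ o' = k₂) ∨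
          (u.get i = x₂ ∧ v.get j = x₁ ∧ o = k₂ ∧ o' = k₁)) ∧
        ∃ q ρ' r, (threeCopies (concatAut aut)).IsAcceptingRun q ρ' r ∧ Describes ρ' R ∧
          Samples ρ' x₁ a₁ k₁ x₂ a₂ k₂ ∧
          (x₁ < x₂ → occ (fun δ => Tag.pos₁ x₂ ∈ δ.2.1) ρ' = 0) := by
    have hord : (u.get i < v.get j ∨ u.get i = v.get j ∧ o < o') ∨
        (v.get j < u.get i ∨ v.get j = u.get i ∧ o' < o) := by
      rcases lt_trichotomy (u.get i) (v.get j) with h | h | h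
      · exact .inl (.inl h)
      · rcases lt_trichotomy o o' with h' | rfl | h'
        · exact .inl (.inr ⟨h, h'⟩)
        -- The same position in the same variable would carry the same letter, contrary to `hab`.
        · exfalso
          rw [show wordsOf R (u.get i) = wordsOf R (v.get j) by rw [h], hj] at hi
          exact hab (Option.some.inj hi).symm
        · exact .inr (.inr ⟨h.symm, h'⟩)
      · exact .inr (.inl h)
    rcases hord with h | h
    · exact ⟨_, _, o, _, _, o', hab, h.elim le_of_lt fun h => h.1.le, .inl ⟨rfl, rfl, rfl, rfl⟩,
        exists_run_samples hacc ht ht' h⟩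
    · exact ⟨_, _, o', _, _, o, hab.symm, h.elim le_of_lt fun h => h.1.le,
        .inr ⟨rfl, rfl, rfl, rfl⟩, exists_run_samples hacc ht' ht h⟩
  obtain ⟨f, hf, hhold⟩ := hrun.exists_values
  refine ⟨f, fun ν ν' κ α hc hκ hα => ?_⟩
  have hc' : (threeCopies (concatAut aut)).CountsRun (α ∘ ν') ρ' := countsRun_congr hf hα
  have htags := countsTags_of_countsRun hc'
  refine ⟨hhold ν' α hα,
    (holds_equalWordFormula_iff hc hρ hR hc' hrun.trans hR').2 fun _ _ _ _ _ => rfl,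
    (holds_symFormula_iff htags hs).2 hne,
    (holds_misFormula_iff htags hR' hs hz hle).2 ⟨i, j, ?_⟩⟩
  rw [hκ]
  zify at hk
  rcases hpos with ⟨h₁, h₂, rfl, rfl⟩ | ⟨h₁, h₂, rfl, rfl⟩
  · exact .inl ⟨h₁, h₂, hk⟩
  · exact .inr ⟨h₁, h₂, hk⟩

end Automata

/-! ### Equisatisfiability -/

section Correctness

variable {A X I : Type*} [Fintype A] [Fintype X] [LinearOrder X] {Q : X → Type*}
  [∀ x, Fintype (Q x)] {aut : ∀ x, NFA A (Q x)} {u v : List X}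
  {ints : List (LIATerm I × LIATerm I)}

theorem holds_intFormula {T S : Type*} {α : Var I T S → ℤ} : (intFormula ints).holds α ↔
    ∀ c ∈ ints, c.1.eval (α ∘ Var.int) ≤ c.2.eval (α ∘ Var.int) := by
  simp only [intFormula, holds_conj, List.mem_map, forall_exists_index, and_imp,
    forall_apply_eq_imp_iff₂, holds, eval_rename]

theorem satisfiable_of_notContainsSatisfiable (hu : u ≠ [])
    (h : NotContainsSatisfiable aut ints u v) :
    (LIAFormula.and (intFormula ints) (formula I aut u v)).Satisfiable := by
  classical
  obtain ⟨σ, η, hσ, hη, hnot⟩ := h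
  have : Nonempty X := ⟨u.head hu⟩
  choose R hR hRσ using fun x => NFA.mem_accepts_iff.1 (hσ x)
  obtain rfl : wordsOf R = σ := funext hRσ
  obtain ⟨p, ρ, r, hrun, hdesc⟩ := exists_run_describes hR
  obtain ⟨f, hf, hhold⟩ := hrun.exists_values
  -- The zeros are placeholders: `offset` and the relevant `snd` variables are bound by the
  -- quantifiers.
  let α : Var I (Tag A X) ((Σ x, Q x) × Fin 3) → ℤ
    | .int i => η i
    | .fst p => f p
    | .snd _ => 0
    | .offset => 0
  refine ⟨α, holds_intFormula.2 hη, hhold .fst α fun _ _ => rfl, fun β hβ => ?_⟩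
  have hβf (p) : β (.fst p) = f p := hβ _ (by simp)
  have hβs (p) : β (.snd p) = 0 := hβ _ (by simp)
  have hcβ : (threeCopies (concatAut aut)).CountsRun (β ∘ .fst) ρ := by
    rwa [show β ∘ Var.fst = f from funext hβf]
  have hlen (w : List X) := eval_lenSum (countsTags_of_countsRun hcβ) hdesc w
  by_cases hκ : 0 ≤ β .offset ∧ β .offset ≤ (lenDiff .fst u v).eval β
  · obtain ⟨hκ₀, hκ₁⟩ := hκ
    obtain ⟨k, hk⟩ := Int.eq_ofNat_of_zero_le hκ₀
    simp only [lenDiff, eval, hlen, hk] at hκ₁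
    obtain ⟨p, a, b, hpa, hpb, hab⟩ := not_isInfix_iff.1 hnot k (by omega)
    obtain ⟨g, hg⟩ := exists_values_of_mismatch hR hdesc hpa hpb hab hrun.trans
    -- Outside `parikhVars` the `snd` variables are not bound, so `γ` must keep the value 0 that `β`
    -- has there.
    let γ : Var I (Tag A X) ((Σ x, Q x) × Fin 3) → ℤ
      | .snd p => if p ∈ (threeCopies (concatAut aut)).parikhVars then g p else 0
      | x => β x
    refine ⟨γ, ?_, .inl (hg Var.fst Var.snd Var.offset γ hcβ hk fun x hx => if_pos hx)⟩
    rintro (i | q | q | _) hq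
    · rfl
    · rfl
    · rw [hβs]
      refine if_neg fun hq' => hq ?_
      exact Finset.mem_image_of_mem _ hq'
    · rfl
  · refine ⟨β, fun _ _ => rfl, .inr ?_⟩
    rw [not_and_or, not_le, not_le] at hκ
    exact hκ

theorem notContainsSatisfiable_of_satisfiable (hu : u ≠ [])
    (hflat : ∀ x, x ∈ u ∨ x ∈ v → (aut x).IsFlat)
    (h : (LIAFormula.and (intFormula ints) (formula I aut u v)).Satisfiable) :
    NotContainsSatisfiable aut ints u v := by
  classical
  have : Nonempty X := ⟨u.head hu⟩
  obtain ⟨α, hint, hpar, hall⟩ := h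
  obtain ⟨p, ρ, r, hrun, hc⟩ := exists_run_of_holds hpar
  obtain ⟨R, hacc, hR, -⟩ := exists_describes hrun
  refine ⟨wordsOf R, α ∘ .int, fun x => NFA.mem_accepts_iff.2 ⟨R x, hacc x, rfl⟩,
    holds_intFormula.1 hint, not_isInfix_iff.2 fun k hk => ?_⟩
  -- The universal offset is instantiated with the candidate `k`. The bound `hk` will refute the two
  -- disjuncts about offsets out of range.
  obtain ⟨γ, hγ, hm⟩ := hall (fun x => match x with | .offset => (k : ℤ) | x => α x) (by
    rintro (i | q | q | _) hq
    · rfl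
    · rfl
    · rfl
    · simp at hq)
  have hγo : γ .offset = k := hγ _ (by simp)
  have hγf : γ ∘ .fst = α ∘ .fst := funext fun q => hγ _ (by simp)
  have hcγ : (threeCopies (concatAut aut)).CountsRun (γ ∘ .fst) ρ := hγf ▸ hc
  have hlen (w : List X) := eval_lenSum (countsTags_of_countsRun hcγ) hR w
  rcases hm with ⟨h₁, h₂, h₃, h₄⟩ | hm | hm
  · obtain ⟨p, q, a, b, hp, hq, hab, hpq⟩ :=
      exists_mismatch_of_holds hflat hcγ hrun.trans hR hacc h₁ h₂ h₃ h₄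
    obtain rfl : k + p = q := by omega
    exact ⟨p, a, b, hp, hq, hab⟩
  · simp only [holds_lt, eval, hγo] at hm
    omega
  · simp only [holds_lt, lenDiff, eval, hγo, hlen] at hm
    omega

end Correctness

end NotContains

/-! ### The size of the formula -/

namespace LIATerm

variable {V : Type*}

theorem size_sum_le {l : List (LIATerm V)} {c k : ℕ} (h : ∀ t ∈ l, t.size ≤ c)
    (hk : l.length ≤ k) : (LIATerm.sum l).size ≤ k * (c + 1) + 1 := by
  refine le_trans ?_ (Nat.add_le_add_right (Nat.mul_le_mul_right _ hk) 1)
  clear hk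
  induction l with
  | nil => simp [sum, size]
  | cons t l ih =>
    obtain ⟨h₁, h₂⟩ := List.forall_mem_cons.1 h
    have := ih h₂
    rw [List.length_cons, add_mul, one_mul]
    simp only [sum, List.foldr_cons, size] at this ⊢
    omega

end LIATerm

namespace LIAFormula

variable {V : Type*}

/-- Each member costs one further symbol for its connective, and 3 is the size of the empty
conjunction `0 ≤ 0`. The empty disjunction `1 ≤ 0` has size 4, since the constant 1 counts for two
symbols. -/
theorem size_conj_le {l : List (LIAFormula V)} {c k : ℕ} (h : ∀ φ ∈ l, φ.size ≤ c)
    (hk : l.length ≤ k) : (conj l).size ≤ k * (c + 1) + 3 := by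
  refine le_trans ?_ (Nat.add_le_add_right (Nat.mul_le_mul_right _ hk) 3)
  clear hk
  induction l with
  | nil => simp [conj, size, LIATerm.size]
  | cons t l ih =>
    obtain ⟨h₁, h₂⟩ := List.forall_mem_cons.1 h
    have := ih h₂
    rw [List.length_cons, add_mul, one_mul]
    simp only [conj, List.foldr_cons, size] at this ⊢
    omega

theorem size_disj_le {l : List (LIAFormula V)} {c k : ℕ} (h : ∀ φ ∈ l, φ.size ≤ c)
    (hk : l.length ≤ k) : (disj l).size ≤ k * (c + 1) + 4 := by
  refine le_trans ?_ (Nat.add_le_add_right (Nat.mul_le_mul_right _ hk) 4)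
  clear hk
  induction l with
  | nil => simp [disj, size, LIATerm.size]
  | cons t l ih =>
    obtain ⟨h₁, h₂⟩ := List.forall_mem_cons.1 h
    have := ih h₂
    rw [List.length_cons, add_mul, one_mul]
    simp only [disj, List.foldr_cons, size] at this ⊢
    omega

end LIAFormula

theorem nat_size_two : Nat.size 2 = 2 := by
  simpa using Nat.size_pow (n := 1)

namespace TagAutomaton

open LIATerm LIAFormula

variable {T S V : Type*} {B : TagAutomaton T S} {ν : ParikhVar T S → V} {M : ℕ}

theorem size_transSum_le (ht : B.trans.card ≤ M) (P) : (B.transSum ν P).size ≤ 2 * M + 1 := by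
  classical
  refine (size_sum_le (c := 1) (k := M) ?_ ?_).trans (by omega)
  · exact List.forall_mem_map.2 fun _ _ => by simp [LIATerm.size]
  · rw [List.length_map, Finset.length_toList]
    exact (Finset.card_filter_le _ _).trans ht

theorem size_kirchhoffFormula_le (ht : B.trans.card ≤ M) (q : S) :
    (B.kirchhoffFormula ν q).size ≤ 4 * M + 7 := by
  have h (P) := size_transSum_le (ν := ν) ht P
  have h₁ := h fun δ => δ.2.2 = q
  have h₂ := h fun δ => δ.1 = q
  simp only [kirchhoffFormula, LIAFormula.size, LIATerm.size]
  omega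

theorem size_spanFormula_le (ht : B.trans.card ≤ M) (q : S) :
    (B.spanFormula ν q).size ≤ 22 * M + 46 := by
  classical
  have hlen : (B.trans.filter fun δ => δ.2.2 = q).toList.length ≤ M := by
    rw [Finset.length_toList]
    exact (Finset.card_filter_le _ _).trans ht
  have h₁ := size_conj_le (c := 3) (k := M)
    (l := (B.trans.filter fun δ => δ.2.2 = q).toList.map fun δ =>
      eq (var (ν (.trans δ))) (const 0)) (List.forall_mem_map.2 fun _ _ => by simp [LIAFormula.size, LIATerm.size])
    (by rwa [List.length_map])
  have h₂ := size_disj_le (c := 17) (k := M)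
    (l := (B.trans.filter fun δ => δ.2.2 = q).toList.map fun δ =>
          and (lt (const 0) (var (ν (.trans δ))))
            (and (le (const 0) (var (ν (.span δ.1))))
              (eq (var (ν (.span q))) (add (var (ν (.span δ.1))) (const 1)))))
    (List.forall_mem_map.2 fun _ _ => by simp [lt, LIAFormula.size, LIATerm.size])
    (by rwa [List.length_map])
  simp only [spanFormula, iff, imp, lt, LIAFormula.size, LIATerm.size, Int.natAbs_zero,
    Int.natAbs_one, Int.natAbs_neg, Nat.size_zero, Nat.size_one] at h₁ h₂ ⊢
  omega

variable [Fintype S]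

theorem size_initFormula_le (hS : Fintype.card S ≤ M) :
    (B.initFormula ν).size ≤ 15 * M + 12 := by
  classical
  have hlen (s : Finset S) : s.toList.length ≤ M := by
    rw [Finset.length_toList]
    exact (Finset.card_le_univ _).trans hS
  have h₁ := size_conj_le (c := 8) (k := M) (l := B.init.toList.map fun q =>
        and (le (const 0) (var (ν (.init q)))) (le (var (ν (.init q))) (const 1)))
    (List.forall_mem_map.2 fun _ _ => by simp [LIAFormula.size, LIATerm.size]) (by rw [List.length_map]; exact hlen _)
  have h₂ := size_conj_le (c := 3) (k := M)
    (l := (Finset.univ \ B.init).toList.map fun q => eq (var (ν (.init q))) (const 0))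
    (List.forall_mem_map.2 fun _ _ => by simp [LIAFormula.size, LIATerm.size]) (by rw [List.length_map]; exact hlen _)
  have h₃ := size_sum_le (c := 1) (k := M)
    (l := B.init.toList.map fun q => var (ν (.init q)))
    (List.forall_mem_map.2 fun _ _ => by simp [LIATerm.size]) (by rw [List.length_map]; exact hlen _)
  simp only [initFormula, LIAFormula.size, LIATerm.size, Int.natAbs_one, Nat.size_one] at h₁ h₂ h₃ ⊢
  omega

theorem size_finalFormula_le (hS : Fintype.card S ≤ M) :
    (B.finalFormula ν).size ≤ 13 * M + 7 := by
  classical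
  have hlen (s : Finset S) : s.toList.length ≤ M := by
    rw [Finset.length_toList]
    exact (Finset.card_le_univ _).trans hS
  have h₁ := size_conj_le (c := 8) (k := M) (l := B.final.toList.map fun q =>
        and (le (const 0) (var (ν (.final q)))) (le (var (ν (.final q))) (const 1)))
    (List.forall_mem_map.2 fun _ _ => by simp [LIAFormula.size, LIATerm.size]) (by rw [List.length_map]; exact hlen _)
  have h₂ := size_conj_le (c := 3) (k := M)
    (l := (Finset.univ \ B.final).toList.map fun q => eq (var (ν (.final q))) (const 0))
    (List.forall_mem_map.2 fun _ _ => by simp [LIAFormula.size, LIATerm.size]) (by rw [List.length_map]; exact hlen _)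
  simp only [finalFormula, LIAFormula.size] at h₁ h₂ ⊢
  omega

theorem size_parikhTagFormula_le (hM : 1 ≤ M) (hS : Fintype.card S ≤ M)
    (ht : B.trans.card ≤ M) (hg : B.tags.card ≤ M) :
    (B.parikhTagFormula ν).size ≤ 160 * M ^ 2 := by
  classical
  have h₁ := size_initFormula_le (B := B) (ν := ν) hS
  have h₂ := size_finalFormula_le (B := B) (ν := ν) hS
  have h₃ := size_conj_le (c := 26 * M + 54) (k := M)
    (l := (Finset.univ : Finset S).toList.map fun q =>
          and (B.kirchhoffFormula ν q) (B.spanFormula ν q)) (by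
      simp only [List.mem_map, forall_exists_index, and_imp, forall_apply_eq_imp_iff₂]
      intro q _
      have := size_kirchhoffFormula_le (ν := ν) ht q
      have := size_spanFormula_le (ν := ν) ht q
      simp only [LIAFormula.size]
      omega) (by rwa [List.length_map, Finset.length_toList])
  have h₄ := size_conj_le (c := 3) (k := M)
    (l := B.trans.toList.map fun δ => le (const 0) (var (ν (.trans δ))))
    (List.forall_mem_map.2 fun _ _ => by simp [LIAFormula.size, LIATerm.size]) (by rwa [List.length_map, Finset.length_toList])
  have h₅ := size_conj_le (c := 2 * M + 3) (k := M)
    (l := B.tags.toList.map fun t =>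
      eq (var (ν (.tag t))) (B.transSum ν fun δ => t ∈ δ.2.1)) (by
      simp only [List.mem_map, forall_exists_index, and_imp, forall_apply_eq_imp_iff₂]
      intro t _
      have := size_transSum_le (ν := ν) ht fun δ => t ∈ δ.2.1
      simp only [LIAFormula.size, LIATerm.size]
      omega) (by rwa [List.length_map, Finset.length_toList])
  -- With the four connectives the bounds add up to `28 * M ^ 2 + 91 * M + 32`, which is at most
  -- `151 * M ^ 2` by `hM`.
  simp only [parikhTagFormula, parikhFormula, LIAFormula.size]
  nlinarith

omit [Fintype S] in
theorem card_parikhVars_le [Fintype S] (hS : Fintype.card S ≤ M) (ht : B.trans.card ≤ M)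
    (hg : B.tags.card ≤ M) : B.parikhVars.card ≤ 5 * M := by
  classical
  have h₁ := (Finset.card_image_le (s := B.trans) (f := ParikhVar.trans)).trans ht
  have h₂ := (Finset.card_image_le (s := B.tags) (f := ParikhVar.tag (S := S))).trans hg
  have h₃ (f : S → ParikhVar T S) := (Finset.card_image_le (s := Finset.univ) (f := f)).trans hS
  unfold parikhVars
  refine (Finset.card_union_le _ _).trans ?_
  refine (Nat.add_le_add ((Finset.card_union_le _ _).trans (Nat.add_le_add
    ((Finset.card_union_le _ _).trans (Nat.add_le_add ((Finset.card_union_le _ _).trans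
      (Nat.add_le_add h₁ h₂)) (h₃ _))) (h₃ _))) (h₃ _)).trans ?_
  omega

end TagAutomaton

/-! ### Size of the whole formula in terms of the input -/

namespace NotContains

open LIATerm LIAFormula TagAutomaton

section Size

variable {A X V S : Type*} {M : ℕ}

theorem size_lenSum_le {ν : ParikhVar (Tag A X) S → V} {w : List X} (hw : w.length ≤ M) :
    (lenSum ν w).size ≤ 2 * M + 1 := by
  refine (size_sum_le (c := 1) (k := M) ?_ (by rwa [List.length_map])).trans (by omega)
  simp [tagCount, LIATerm.size]

variable [Fintype A] [Fintype X] {ν : ParikhVar (Tag A X) S → V}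

theorem size_symFormula_le (hA : Fintype.card A ≤ M) (hX : Fintype.card X ≤ M) :
    (symFormula ν).size ≤ M * (4 * M + 9) + 3 := by
  refine size_conj_le ?_ (by rwa [List.length_map, Finset.length_toList])
  simp only [List.mem_map, forall_exists_index, and_imp, forall_apply_eq_imp_iff₂]
  intro a _
  have := size_sum_le (c := 3) (k := M)
    (l := (Finset.univ : Finset X).toList.map fun x =>
      add (tagCount ν (.mis₁ a x)) (tagCount ν (.mis₂ a x)))
    (List.forall_mem_map.2 fun _ _ => by simp [tagCount, LIATerm.size]) (by rwa [List.length_map, Finset.length_toList])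
  simp only [lt, LIAFormula.size, LIATerm.size, Int.natAbs_one, Nat.size_one, show Int.natAbs 2 = 2 from rfl,
    nat_size_two]
  omega

omit [Fintype X] in
theorem size_sampledFormula_le (hA : Fintype.card A ≤ M) (x y : X) :
    (sampledFormula ν x y).size ≤ 4 * M + 13 := by
  have h (f : A → Tag A X) := size_sum_le (c := 1) (k := M)
    (l := (Finset.univ : Finset A).toList.map fun a => tagCount ν (f a))
    (List.forall_mem_map.2 fun _ _ => by simp [tagCount, LIATerm.size]) (by rwa [List.length_map, Finset.length_toList])
  have h₁ := h fun a => .mis₁ a x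
  have h₂ := h fun a => .mis₂ a y
  simp only [sampledFormula, lt, LIAFormula.size, LIATerm.size, Int.natAbs_one, Nat.size_one,
    Int.natAbs_zero, Nat.size_zero]
  omega

variable [LinearOrder X]

omit [Fintype X] in
theorem size_misFormula_le (hA : Fintype.card A ≤ M) {κ : V} {u v : List X} (hu : u.length ≤ M)
    (hv : v.length ≤ M) : (misFormula κ ν u v).size ≤ M * M * (12 * M + 46) + 4 := by
  refine size_disj_le ?_ ?_
  · simp only [List.mem_flatMap, List.mem_map, List.mem_finRange, true_and]
    rintro _ ⟨i, j, rfl⟩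
    have hpos : (posFormula κ ν u v i j).size ≤ 8 * M + 31 := by
      have h₁ : (lenSum ν (u.take i)).size ≤ 2 * M + 1 :=
        size_lenSum_le ((List.length_take_le _ _).trans (i.2.le.trans hu))
      have h₂ : (lenSum ν (v.take j)).size ≤ 2 * M + 1 :=
        size_lenSum_le ((List.length_take_le _ _).trans (j.2.le.trans hv))
      simp only [posFormula]
      split_ifs <;> simp only [tagCount, LIAFormula.size, LIATerm.size] <;> omega
    have hs (x y : X) := size_sampledFormula_le (ν := ν) hA x y
    rw [LIAFormula.size]
    have : (if u.get i ≤ v.get j then sampledFormula ν (u.get i) (v.get j)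
        else sampledFormula ν (v.get j) (u.get i)).size ≤ 4 * M + 13 := by
      split_ifs
      · exact hs _ _
      · exact hs _ _
    omega
  · rw [List.length_flatMap]
    simp only [List.length_map, List.length_finRange, List.map_const', List.sum_replicate,
      smul_eq_mul]
    exact Nat.mul_le_mul hu hv

omit [LinearOrder X] in
theorem size_equalWordFormula_le {S : Type*} [Fintype S] {C : TagAutomaton (Tag A X) S}
    {ν₁ ν₂ : ParikhVar (Tag A X) (S × Fin 3) → V} (hAX : Fintype.card (A × X) ≤ M)
    (hC : C.trans.card ≤ M) (ht : (threeCopies C).trans.card ≤ M) :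
    (equalWordFormula C ν₁ ν₂).size ≤ M * M * (4 * M + 4) + 3 := by
  classical
  refine size_conj_le ?_ ?_
  · simp only [List.mem_flatMap, List.mem_map]
    rintro _ ⟨p, _, t, _, rfl⟩
    have h₁ (P) := size_transSum_le (ν := ν₁) ht P
    have h₂ (P) := size_transSum_le (ν := ν₂) ht P
    simp only [LIAFormula.size]
    grw [h₁, h₂]
    omega
  · rw [List.length_flatMap]
    refine (List.sum_le_card_nsmul _ M ?_).trans ?_
    · simp only [List.mem_map, forall_exists_index, and_imp, forall_apply_eq_imp_iff₂,
        List.length_map, Finset.length_toList]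
      intro p _
      exact (Finset.card_filter_le _ _).trans hC
    · rw [List.length_map, Finset.length_toList, smul_eq_mul]
      exact Nat.mul_le_mul_right _ hAX

variable {Q : X → Type*} [∀ x, Fintype (Q x)] {aut : ∀ x, NFA A (Q x)}

/-- The cubic terms come from the mismatch and equal-word formulae, which have up to `M * M` members
of linear size each. -/
theorem size_formula_le (I : Type*) (hM : 1 ≤ M) {u v : List X} (hu : u.length ≤ M)
    (hv : v.length ≤ M) (hA : Fintype.card A ≤ M) (hX : Fintype.card X ≤ M)
    (hAX : Fintype.card (A × X) ≤ M) (hS : Fintype.card ((Σ x, Q x) × Fin 3) ≤ M)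
    (hC : (concatAut aut).trans.card ≤ M) (ht : (threeCopies (concatAut aut)).trans.card ≤ M)
    (hg : (threeCopies (concatAut aut)).tags.card ≤ M) :
    (formula I aut u v).size ≤ 500 * M ^ 3 := by
  classical
  have h₈ := size_parikhTagFormula_le (ν := Var.fst (I := I)) hM hS ht hg
  have h₉ := size_parikhTagFormula_le (ν := Var.snd (I := I)) hM hS ht hg
  have h₂ := size_equalWordFormula_le (ν₁ := Var.fst (I := I)) (ν₂ := Var.snd) hAX hC ht
  have h₃ := size_symFormula_le (ν := Var.snd (I := I) (S := (Σ x, Q x) × Fin 3)) hA hX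
  have h₄ := size_misFormula_le (ν := Var.snd (I := I) (S := (Σ x, Q x) × Fin 3)) (κ := .offset)
    hA hu hv
  have h₅ := size_lenSum_le (A := A) (ν := Var.fst (I := I) (S := (Σ x, Q x) × Fin 3)) hu
  have h₆ := size_lenSum_le (A := A) (ν := Var.fst (I := I) (S := (Σ x, Q x) × Fin 3)) hv
  have h₇ := (Finset.card_image_le (s := (threeCopies (concatAut aut)).parikhVars)
    (f := Var.snd (I := I))).trans (card_parikhVars_le hS ht hg)
  simp only [formula, lt, lenDiff, LIAFormula.size, LIATerm.size, Finset.card_singleton,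
    Int.natAbs_one, Nat.size_one, Int.natAbs_zero, Nat.size_zero]
  simp only [concatAut] at h₂ h₇ h₈ h₉
  have e₁ : M ≤ M ^ 2 := Nat.le_self_pow two_ne_zero M
  have e₂ : M ^ 2 ≤ M ^ 3 := Nat.pow_le_pow_right hM (by omega)
  ring_nf at *
  omega

theorem card_concatAut_trans_le : (concatAut aut).trans.card ≤
    Fintype.card X * (Fintype.card (Σ x, Q x) * (Fintype.card A * Fintype.card (Σ x, Q x))) +
      Fintype.card (Σ x, Q x) * Fintype.card (Σ x, Q x) := by
  classical
  refine (Finset.card_union_le _ _).trans (Nat.add_le_add ?_ ?_)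
  · refine Finset.card_biUnion_le_card_mul _ _ _ fun x _ => Finset.card_image_le.trans ?_
    refine Finset.card_image_le.trans ((Finset.card_filter_le _ _).trans ?_)
    have hx : Fintype.card (Q x) ≤ Fintype.card (Σ x, Q x) :=
      Fintype.card_le_of_injective _ sigma_mk_injective
    rw [Finset.card_univ, Fintype.card_prod, Fintype.card_prod]
    gcongr
  · refine Finset.card_image_le.trans ((Finset.card_filter_le _ _).trans ?_)
    rw [Finset.card_univ, Fintype.card_prod]

omit [LinearOrder X] in
theorem card_threeCopies_trans_le {S : Type*} [Fintype S] (C : TagAutomaton (Tag A X) S) :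
    (threeCopies C).trans.card ≤
      Fintype.card A * Fintype.card X * (C.trans.card * 5) + C.trans.card * 3 := by
  classical
  refine (Finset.card_union_le _ _).trans (Nat.add_le_add ?_ ?_)
  · rw [← Fintype.card_prod, ← Finset.card_univ]
    refine Finset.card_biUnion_le_card_mul _ _ _ fun p _ => ?_
    refine (Finset.card_biUnion_le_card_mul _ _ 5 fun t _ => Finset.card_le_five).trans ?_
    exact Nat.mul_le_mul_right _ (Finset.card_filter_le _ _)
  · refine (Finset.card_biUnion_le_card_mul _ _ 3 fun t _ => Finset.card_image_le).trans ?_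
    exact Nat.mul_le_mul_right _ (Finset.card_filter_le _ _)

theorem card_threeCopies_tags_le : (threeCopies (concatAut aut)).tags.card ≤
    Fintype.card X * (3 * Fintype.card A + 4) := by
  classical
  have h₁ (f : A × X → Tag A X) :=
    (Finset.card_image_le (s := Finset.univ) (f := f)).trans_eq
      (Finset.card_univ.trans (Fintype.card_prod A X))
  have h₂ (f : X → Tag A X) :=
    (Finset.card_image_le (s := Finset.univ) (f := f)).trans_eq Finset.card_univ
  have h₃ : (concatAut aut).tags.card ≤ Fintype.card X * (Fintype.card A + 1) := by
    refine Finset.card_biUnion_le_card_mul _ _ _ fun x _ => ?_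
    refine (Finset.card_union_le _ _).trans ?_
    rw [Finset.card_singleton]
    exact Nat.add_le_add_right Finset.card_image_le 1
  refine (Finset.card_union_le _ _).trans ?_
  refine (Nat.add_le_add ((Finset.card_union_le _ _).trans (Nat.add_le_add
    ((Finset.card_union_le _ _).trans (Nat.add_le_add ((Finset.card_union_le _ _).trans
      (Nat.add_le_add ((Finset.card_union_le _ _).trans (Nat.add_le_add h₃ (h₁ _))) (h₁ _)))
        (h₂ _))) (h₂ _))) (h₂ _)).trans ?_
  apply le_of_eq
  ring

theorem size_formula_le_of_nonempty (I : Type*) {u v : List X} (hu : u ≠ []) (hv : v ≠ [])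
    (hQ : ∀ x, Nonempty (Q x)) : (formula I aut u v).size ≤
      500 * (8 * (Fintype.card A + 1) ^ 2 *
        (u.length * v.length * ∑ x, Fintype.card (Q x)) ^ 4) ^ 3 := by
  rw [← Fintype.card_sigma]
  have hu' := List.length_pos_iff.2 hu
  have hv' := List.length_pos_iff.2 hv
  have hX₀ : 0 < Fintype.card X := Fintype.card_pos_iff.2 ⟨u.head hu⟩
  -- Every automaton has a state, so the number of variables is controlled by the number of states.
  have hXr : Fintype.card X ≤ Fintype.card (Σ x, Q x) :=
    Fintype.card_le_of_injective (fun x => ⟨x, (hQ x).some⟩) fun x y h => congrArg Sigma.fst h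
  have hc := card_concatAut_trans_le (aut := aut)
  have ht := card_threeCopies_trans_le (concatAut aut)
  have hg := card_threeCopies_tags_le (aut := aut)
  set a := Fintype.card A
  set r := Fintype.card (Σ x, Q x)
  set N := u.length * v.length * r with hN
  have hr : 0 < r := hX₀.trans_le hXr
  have hrN : r ≤ N := Nat.le_mul_of_pos_left _ (Nat.mul_pos hu' hv')
  have huN : u.length ≤ N := by
    rw [hN, mul_assoc]
    exact Nat.le_mul_of_pos_right _ (Nat.mul_pos hv' hr)
  have hvN : v.length ≤ N := by
    rw [hN, mul_comm u.length, mul_assoc]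
    exact Nat.le_mul_of_pos_right _ (Nat.mul_pos hu' hr)
  have hN₁ : 1 ≤ N := hr.trans_le hrN
  have hXN : Fintype.card X ≤ N := hXr.trans hrN
  have hc' : (concatAut aut).trans.card ≤ (a + 1) * N ^ 3 := by
    have : N ^ 2 ≤ N ^ 3 := Nat.pow_le_pow_right hN₁ (by omega)
    calc _ ≤ _ := hc
      _ ≤ N * (N * (a * N)) + N * N := by gcongr
      _ = a * N ^ 3 + N ^ 2 := by ring
      _ ≤ _ := by rw [add_mul, one_mul]; omega
  -- The value is dictated by the transitions of `threeCopies`: five for each letter transition and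
  -- three for each untagged one, whence 8 = 5 + 3. The other quantities are smaller.
  set M := 8 * (a + 1) ^ 2 * N ^ 4 with hM
  have ht' : (threeCopies (concatAut aut)).trans.card ≤ M := by
    calc _ ≤ _ := ht
      _ ≤ a * N * ((a + 1) * N ^ 3 * 5) + (a + 1) * N ^ 3 * 3 := by gcongr
      _ ≤ (a + 1) * N * ((a + 1) * N ^ 3 * 5) + (a + 1) * N ^ 3 * 3 * ((a + 1) * N) := by
        refine Nat.add_le_add ?_ (Nat.le_mul_of_pos_right _ (by positivity))
        gcongr
        omega
      _ = M := by rw [hM]; ring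
  have hle : 8 * ((a + 1) * N) ≤ M := by
    have h₁ : a + 1 ≤ (a + 1) ^ 2 := Nat.le_self_pow two_ne_zero _
    have h₂ : N ≤ N ^ 4 := Nat.le_self_pow four_ne_zero _
    rw [hM, mul_assoc]
    gcongr
  have haN : a + 1 ≤ (a + 1) * N := Nat.le_mul_of_pos_right _ hN₁
  have hNa : N ≤ (a + 1) * N := Nat.le_mul_of_pos_left _ (by omega)
  refine size_formula_le I ?_ ?_ ?_ ?_ ?_ ?_ ?_ ?_ ht' ?_
  · omega
  · omega
  · omega
  · change a ≤ M; omega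
  · omega
  · rw [Fintype.card_prod]
    refine le_trans (Nat.mul_le_mul (Nat.le_succ a) hXN) ?_
    change (a + 1) * N ≤ M
    omega
  · rw [Fintype.card_prod, Fintype.card_fin]
    change r * 3 ≤ M
    omega
  · refine hc'.trans ?_
    rw [hM]
    have h₁ : a + 1 ≤ 8 * (a + 1) ^ 2 :=
      (Nat.le_self_pow two_ne_zero _).trans (Nat.le_mul_of_pos_left _ (by omega))
    have h₂ : N ^ 3 ≤ N ^ 4 := Nat.pow_le_pow_right hN₁ (by omega)
    gcongr
  · calc _ ≤ _ := hg
      _ ≤ N * (3 * a + 4) := by gcongr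
      _ ≤ N * (8 * (a + 1)) := by gcongr; omega
      _ = 8 * ((a + 1) * N) := by ring
      _ ≤ M := hle

end Size

end NotContains

theorem mainTheorem8 (A : Type*) [Fintype A] [Nonempty A] :
    ∃ p : Polynomial ℕ,
      ∀ (X : Type*) [Fintype X] [LinearOrder X] (I : Type*)
        (Q : X → Type*) [∀ x, Fintype (Q x)] (aut : ∀ x, NFA A (Q x))
        (u v : List X), u ≠ [] → v ≠ [] →
        (∀ x, x ∈ u ∨ x ∈ v → (aut x).IsFlat) →
        (∀ ints : List (LIATerm I × LIATerm I),
          NotContainsSatisfiable aut ints u v ↔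
            (LIAFormula.and (NotContains.intFormula ints)
              (NotContains.formula I aut u v)).Satisfiable) ∧
        ((∀ x, Nonempty (Q x)) →
          (NotContains.formula I aut u v).size ≤
            p.eval (u.length * v.length * ∑ x, Fintype.card (Q x))) := by
  -- The bound `500 * M ^ 3` at `M = 8 * (Fintype.card A + 1) ^ 2 * N ^ 4`, where `N` is the
  -- argument of the polynomial.
  refine ⟨.C (500 * (8 * (Fintype.card A + 1) ^ 2) ^ 3) * .X ^ 12, ?_⟩
  intro X _ _ I Q _ aut u v hu hv hflat
  refine ⟨fun ints => ⟨NotContains.satisfiable_of_notContainsSatisfiable hu,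
    NotContains.notContainsSatisfiable_of_satisfiable hu hflat⟩, fun hQ => ?_⟩
  refine (NotContains.size_formula_le_of_nonempty I hu hv hQ).trans (le_of_eq ?_)
  rw [Polynomial.eval_mul, Polynomial.eval_C, Polynomial.eval_pow, Polynomial.eval_X]
  ring
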